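/- Let $\mathbf F$ be an algebraic closure of the field with two elements. Let $\cdots \to C_{i+1}\to C_i\to\cdots\to C_1\to C_0=\mathbb P^1$ be the tower of smooth projective curves over $\mathbf F$ in which $C_0$ has affine coordinate $x_0$ and, for every $i\ge 0$, the cover $C_{i+1}\to C_i$ is given by the affine equation $$x_{i+1}^2+x_{i+1}=x_i+1+\frac1{x_i};$$ that is, $C_i$ is the smooth projective curve over $\mathbf F$ with function field $\mathbf F(x_0,\dots,x_i)$, where $x_0$ is transcendental over $\mathbf F$. For $i\ge 0$ let $n_i$ be the number of points $P$ of $C_i$ that are totally ramified in $C_{i+1}/C_i$ (i.e. some point of $C_{i+1}$ above $P$ has ramification index equal to the degree of $C_{i+1}\to C_i$). Then $n_i$ is finite and $$n_i=\begin{cases}\left(\left[\frac{i+2}{4}\right]+2\right)2^{i/2} & \text{for } i \text{ even},\\[4pt] \left(\left[\frac{i}{4}\right]+2\right)2^{(i+1)/2} & \text{for } i \text{ odd},\end{cases}$$ where $[a]$ denotes the greatest integer not exceeding $a$. -/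

import Mathlib

/-- A point of the smooth projective curve over an algebraically closed field `k` with function
field `K`: a discrete valuation ring of `K` that contains `k` and has fraction field `K`. -/
structure CurvePoint (k K : Type*) [Field k] [Field K] [Algebra k K] where
  /-- The local ring of the point, as a subring of the function field. -/
  localRing : ValuationSubring K
  algebraMap_mem : ∀ c : k, algebraMap k K c ∈ localRing
  isDVR : IsDiscreteValuationRing localRing

namespace CurvePoint

/-- For an extension `L / K` of function fields, corresponding to a cover of curves, the point `Q`
of the upper curve is mapped to the point `P` of the lower one. -/
def LiesOver {k K L : Type*} [Field k] [Field K] [Field L] [Algebra k K] [Algebra k L]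
    [Algebra K L] (Q : CurvePoint k L) (P : CurvePoint k K) : Prop :=
  Q.localRing.comap (algebraMap K L) = P.localRing

/-- The homomorphism `O_P → O_Q` of local rings induced by a cover that maps `Q` to `P`. -/
def localHom {k K L : Type*} [Field k] [Field K] [Field L] [Algebra k K] [Algebra k L]
    [Algebra K L] {Q : CurvePoint k L} {P : CurvePoint k K} (h : Q.LiesOver P) :
    P.localRing →+* Q.localRing :=
  (algebraMap K L).restrict P.localRing Q.localRing (fun a ha => by
    have h' : Q.localRing.comap (algebraMap K L) = P.localRing := h
    rw [← h'] at ha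
    exact ha)

/-- `P` is totally ramified in the cover given by `L / K`: some point `Q` over `P` has ramification
index `[L : K]`, that is, `m_P O_Q = m_Q ^ [L : K]`. -/
def IsTotallyRamified {k K : Type*} [Field k] [Field K] [Algebra k K] (P : CurvePoint k K)
    (L : Type*) [Field L] [Algebra k L] [Algebra K L] : Prop :=
  ∃ (Q : CurvePoint k L) (h : Q.LiesOver P),
    (IsLocalRing.maximalIdeal P.localRing).map (localHom h) =
      IsLocalRing.maximalIdeal Q.localRing ^ Module.finrank K L

end CurvePoint

/-- `x₀` is transcendental over `F` (an affine coordinate on the projective line), and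
`x_{i+1}² + x_{i+1} = x_i + 1 + 1 / x_i` for all `i`. (All `x_i` are then nonzero.) -/
structure IsTowerSequence (F : Type*) {Ω : Type*} [Field F] [Field Ω] [Algebra F Ω]
    (x : ℕ → Ω) : Prop where
  transcendental_zero : Transcendental F (x 0)
  equation : ∀ i, x (i + 1) ^ 2 + x (i + 1) = x i + 1 + 1 / x i

/-- Tower sequences exist. -/
theorem exists_isTowerSequence (F : Type*) [Field F] :
    ∃ x : ℕ → AlgebraicClosure (RatFunc F), IsTowerSequence F x := by
  have key : ∀ a : AlgebraicClosure (RatFunc F), ∃ y : AlgebraicClosure (RatFunc F),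
      y ^ 2 + y = a + 1 + 1 / a := by
    intro a
    have hd : (Polynomial.X ^ 2 + Polynomial.X - Polynomial.C (a + 1 + 1 / a)).degree ≠ 0 := by
      have : (Polynomial.X ^ 2 + Polynomial.X - Polynomial.C (a + 1 + 1 / a)).degree = 2 := by
        compute_degree!
      rw [this]
      decide
    obtain ⟨y, hy⟩ := IsAlgClosed.exists_root _ hd
    refine ⟨y, ?_⟩
    simpa [Polynomial.IsRoot, sub_eq_zero] using hy
  choose g hg using key
  refine ⟨fun n => Nat.rec (algebraMap (RatFunc F) _ RatFunc.X) (fun _ a => g a) n, ?_, ?_⟩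
  · exact (transcendental_algebraMap_iff
      (algebraMap (RatFunc F) (AlgebraicClosure (RatFunc F))).injective).2 RatFunc.transcendental_X
  · intro i
    exact hg _

/-- The function field `F(x₀, …, x_i)` of the `i`-th curve `C_i` of the tower. -/
def towerField (F : Type*) {Ω : Type*} [Field F] [Field Ω] [Algebra F Ω] (x : ℕ → Ω) (i : ℕ) :
    IntermediateField F Ω :=
  IntermediateField.adjoin F {y | ∃ j ≤ i, y = x j}

theorem towerField_le_succ (F : Type*) {Ω : Type*} [Field F] [Field Ω] [Algebra F Ω]
    (x : ℕ → Ω) (i : ℕ) : towerField F x i ≤ towerField F x (i + 1) :=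
  IntermediateField.adjoin.mono F _ _ fun _ ⟨j, hj, hy⟩ => ⟨j, Nat.le_succ_of_le hj, hy⟩

/-- The inclusion of function fields given by the cover `C_{i+1} → C_i`. -/
noncomputable instance towerAlgebra (F : Type*) {Ω : Type*} [Field F] [Field Ω] [Algebra F Ω]
    (x : ℕ → Ω) (i : ℕ) : Algebra (towerField F x i) (towerField F x (i + 1)) :=
  (IntermediateField.inclusion (towerField_le_succ F x i)).toRingHom.toAlgebra

/-- The set of points of `C_i` that are totally ramified in `C_{i+1} / C_i`. -/
def totallyRamifiedPoints (F : Type*) {Ω : Type*} [Field F] [Field Ω] [Algebra F Ω]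
    (x : ℕ → Ω) (i : ℕ) : Set (CurvePoint F (towerField F x i)) :=
  {P | P.IsTotallyRamified (towerField F x (i + 1))}

/-! Write ℘(g) = g² + g and f = x_i + 1 + 1/x_i. All residue fields are the algebraically closed F,
so a place of C_i splits into two unramified places when f ≡ ℘(g) modulo functions regular there,
and is totally ramified when f ≡ ℘(g) + (simple pole). The proof classifies places into finitely
many families, each but the generic one indexed by a natural number m, and determines the family of
every place of C_{i+1} from the one below it.

The index m measures how far a pole is from being simple. A pole chain of length m + 1 is y ≡ ω℘(r)
with r a chain of length m and ω a primitive cube root of unity; a dual chain has y ≡ ℘(ωr) instead.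
Since ω℘(r) = ℘(ω²r) + r, a pole chain reduces modulo ℘ to its simple pole, so f being a chain
forces ramification. If moreover z² + z is a chain, then z is a dual chain of the same length
(`PoleChain.dual_of_ramified`). A dual chain of positive length is of the form ℘(g), so the next
step is unramified, and g is a chain of length one less. Thus ramified 0 → ramified 0, ramified
(m+1) → unramified pole m, and unramified pole m → two ramified m.

Poles arise from finite values by partial fractions. Over x = 1 the values of y are the two cube
roots, and 1/(y² + y + 1) = ℘(1/(x+1)) makes the chain one longer: one m → two cubeRoot (m+1). Over
x = ω one has y = 0 or 1, and 1/y + 1/(y+1) = 1/f preserves the chain: cubeRoot m → ramified m and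
one m. Every other finite nonzero value stays away from 0, 1 and the cube roots forever.

Over the base only x₀ = ∞, 0 (both ramified 0), 1 (one 0) and the two cube roots (cubeRoot 0)
contribute. The transition rules give a recursion (`PlaceType.count`, `ncard_ramifiedPointsOver`),
which is then solved in closed form. -/

/-! ### Discrete valuation rings through a uniformizer, and extension of valuation rings -/

namespace ValuationSubring

variable {K L : Type*} [Field K] [Field L] [Algebra K L]

/-- `t` generates the value group of `A`, which is thereby infinite cyclic. -/
def IsUniformizer (A : ValuationSubring K) (t : K) : Prop :=
  t ≠ 0 ∧ A.valuation t < 1 ∧ ∀ z : K, z ≠ 0 → ∃ n : ℤ, A.valuation z = A.valuation t ^ n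

theorem valuation_pos (A : ValuationSubring K) {z : K} (hz : z ≠ 0) : 0 < A.valuation z :=
  zero_lt_iff.2 ((A.valuation.ne_zero_iff).2 hz)

theorem IsUniformizer.valuation_pos {A : ValuationSubring K} {t : K} (h : A.IsUniformizer t) :
    0 < A.valuation t := A.valuation_pos h.1

theorem IsUniformizer.congr {A : ValuationSubring K} {t s : K} (h : A.IsUniformizer t)
    (hs : A.valuation s = A.valuation t) : A.IsUniformizer s := by
  refine ⟨fun h0 => ?_, hs ▸ h.2.1, fun z hz => hs ▸ h.2.2 z hz⟩
  have := h.valuation_pos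
  rw [← hs, h0, map_zero] at this
  exact lt_irrefl _ this

theorem IsUniformizer.exists_nat {A : ValuationSubring K} {t : K} (h : A.IsUniformizer t)
    {z : K} (hz : z ≠ 0) (hzA : z ∈ A) : ∃ n : ℕ, A.valuation z = A.valuation t ^ n := by
  obtain ⟨n, hn⟩ := h.2.2 z hz
  have h1 : A.valuation t ^ n ≤ 1 := by rw [← hn]; exact (A.valuation_le_one_iff z).2 hzA
  have h0 : 0 ≤ n := by
    by_contra hneg
    push Not at hneg
    exact absurd (one_lt_zpow_of_neg₀ h.valuation_pos h.2.1 hneg) (not_lt.2 h1)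
  lift n to ℕ using h0
  exact ⟨n, by rw [hn, zpow_natCast]⟩

theorem IsUniformizer.mem {A : ValuationSubring K} {t : K} (h : A.IsUniformizer t) : t ∈ A :=
  (A.valuation_le_one_iff t).1 h.2.1.le

theorem IsUniformizer.maximalIdeal_eq {A : ValuationSubring K} {t : K} (h : A.IsUniformizer t) :
    IsLocalRing.maximalIdeal A = Ideal.span {⟨t, h.mem⟩} := by
  ext z
  rw [A.valuation_lt_one_iff, Ideal.mem_span_singleton']
  constructor
  · intro hz
    have h1 : A.valuation (z : K) ≤ A.valuation t := by
      by_cases h0 : (z : K) = 0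
      · rw [h0, map_zero]; exact zero_le
      obtain ⟨n, hn⟩ := h.exists_nat h0 z.2
      rw [hn] at hz ⊢
      have : n ≠ 0 := by rintro rfl; simp at hz
      exact pow_le_of_le_one zero_le h.2.1.le this
    obtain ⟨a, ha⟩ := (A.valuation_le_iff _ _).1 h1
    exact ⟨a, Subtype.ext ha⟩
  · rintro ⟨a, rfl⟩
    have : A.valuation (a : K) ≤ 1 := A.valuation_le_one a
    simp only [MulMemClass.coe_mul, map_mul]
    calc _ ≤ 1 * A.valuation t := by gcongr
      _ < 1 := by rw [one_mul]; exact h.2.1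

theorem IsUniformizer.isDiscreteValuationRing {A : ValuationSubring K} {t : K}
    (h : A.IsUniformizer t) : IsDiscreteValuationRing A := by
  have hnat : ∀ z : A, z ≠ 0 → ∃ n : ℕ, A.valuation (z : K) = A.valuation t ^ n := fun z hz =>
    h.exists_nat (fun h0 => hz (Subtype.ext h0)) z.2
  have hunit : ∀ z : A, IsUnit z ↔ A.valuation (z : K) = 1 := fun z => A.valuation_eq_one_iff z
  apply IsDiscreteValuationRing.ofHasUnitMulPowIrreducibleFactorization
  refine ⟨⟨t, h.mem⟩, ⟨fun hu => h.2.1.ne ((hunit _).1 hu), ?_⟩, ?_⟩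
  · intro a b hab
    have ha : a ≠ 0 := by
      rintro rfl
      exact h.1 (by simpa using congrArg Subtype.val hab)
    have hb : b ≠ 0 := by
      rintro rfl
      exact h.1 (by simpa using congrArg Subtype.val hab)
    obtain ⟨n, hn⟩ := hnat a ha
    obtain ⟨m, hm⟩ := hnat b hb
    have h1 : A.valuation t ^ 1 = A.valuation t ^ (n + m) := by
      rw [pow_add, ← hn, ← hm, ← map_mul, pow_one]
      exact congrArg A.valuation (congrArg Subtype.val hab)
    have h2 := pow_right_injective₀ h.valuation_pos h.2.1.ne h1
    rw [hunit, hunit, hn, hm]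
    rcases Nat.eq_zero_or_pos n with h3 | h3
    · left; rw [h3, pow_zero]
    · right
      obtain rfl : m = 0 := by omega
      rw [pow_zero]
  · intro z hz
    obtain ⟨n, hn⟩ := hnat z hz
    refine ⟨n, ?_⟩
    have h1 : A.valuation (z : K) = A.valuation (t ^ n) := by rw [hn, map_pow]
    obtain ⟨u, hu⟩ := (A.valuation_eq_iff _ _).1 h1
    exact ⟨u, Subtype.ext (by simpa [mul_comm] using hu)⟩

theorem exists_isUniformizer (A : ValuationSubring K) [IsDiscreteValuationRing A] :
    ∃ t, A.IsUniformizer t := by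
  obtain ⟨p, hp⟩ := IsDiscreteValuationRing.exists_irreducible A
  have hp0 : (p : K) ≠ 0 := fun h => hp.ne_zero (Subtype.ext h)
  have key : ∀ z : A, z ≠ 0 → ∃ n : ℕ, A.valuation (z : K) = A.valuation (p : K) ^ n := by
    intro z hz
    obtain ⟨n, u, hu⟩ := IsDiscreteValuationRing.eq_unit_mul_pow_irreducible hz hp
    refine ⟨n, ?_⟩
    have : (z : K) = (u : A) * (p : K) ^ n := by rw [hu]; simp
    rw [this, map_mul, A.valuation_unit, one_mul, map_pow]
  refine ⟨p, hp0, (A.valuation_lt_one_iff p).1 (by simpa using hp.not_isUnit), ?_⟩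
  intro z hz
  rcases A.mem_or_inv_mem z with h | h
  · obtain ⟨n, hn⟩ := key ⟨z, h⟩ (fun h0 => hz (congrArg Subtype.val h0))
    exact ⟨n, by simpa using hn⟩
  · obtain ⟨n, hn⟩ := key ⟨z⁻¹, h⟩ (fun h0 => hz (inv_eq_zero.1 (congrArg Subtype.val h0)))
    refine ⟨-n, ?_⟩
    rw [zpow_neg, zpow_natCast, ← hn]
    simp

theorem inv_mem_of_notMem {A : ValuationSubring K} {z : K} (hz : z ∉ A) : A.valuation z⁻¹ < 1 := by
  rw [map_inv₀]
  apply inv_lt_one_of_one_lt₀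
  rw [← not_le, A.valuation_le_one_iff]
  exact hz

theorem valuation_le_iff_div_mem (A : ValuationSubring K) {x y : K} (hy : y ≠ 0) :
    A.valuation x ≤ A.valuation y ↔ x / y ∈ A := by
  rw [← A.valuation_le_one_iff, map_div₀, div_le_one₀ (A.valuation_pos hy)]

section comap

variable {A : ValuationSubring K} {B : ValuationSubring L}

theorem valuation_algebraMap_le_iff (h : B.comap (algebraMap K L) = A) (a b : K) :
    B.valuation (algebraMap K L a) ≤ B.valuation (algebraMap K L b) ↔
      A.valuation a ≤ A.valuation b := by
  subst h
  by_cases hb : b = 0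
  · subst hb; simp
  rw [valuation_le_iff_div_mem _ hb, valuation_le_iff_div_mem _ (by simpa using hb), ← map_div₀]
  rfl

theorem valuation_algebraMap_lt_iff (h : B.comap (algebraMap K L) = A) (a b : K) :
    B.valuation (algebraMap K L a) < B.valuation (algebraMap K L b) ↔
      A.valuation a < A.valuation b := by
  rw [← not_le, ← not_le, valuation_algebraMap_le_iff h]

theorem valuation_algebraMap_eq_iff (h : B.comap (algebraMap K L) = A) (a b : K) :
    B.valuation (algebraMap K L a) = B.valuation (algebraMap K L b) ↔
      A.valuation a = A.valuation b := by
  rw [le_antisymm_iff, le_antisymm_iff, valuation_algebraMap_le_iff h,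
    valuation_algebraMap_le_iff h]

theorem valuation_algebraMap_lt_one_iff (h : B.comap (algebraMap K L) = A) (a : K) :
    B.valuation (algebraMap K L a) < 1 ↔ A.valuation a < 1 := by
  have := valuation_algebraMap_lt_iff h a 1
  simpa using this

theorem algebraMap_mem_iff (h : B.comap (algebraMap K L) = A) (a : K) :
    algebraMap K L a ∈ B ↔ a ∈ A := by
  subst h; rfl

theorem IsUniformizer.valuation_algebraMap {t : K} (ht : A.IsUniformizer t)
    (h : B.comap (algebraMap K L) = A) {z : K} (hz : z ≠ 0) :
    ∃ n : ℤ, B.valuation (algebraMap K L z) = B.valuation (algebraMap K L t) ^ n := by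
  obtain ⟨n, hn⟩ := ht.2.2 z hz
  refine ⟨n, ?_⟩
  rw [← map_zpow₀, ← map_zpow₀, valuation_algebraMap_eq_iff h, hn, map_zpow₀]

end comap

/-- Every valuation ring of `K` has an extension to `L`. -/
theorem exists_comap_eq (L : Type*) [Field L] [Algebra K L] (A : ValuationSubring K) :
    ∃ B : ValuationSubring L, B.comap (algebraMap K L) = A := by
  let e : A ≃+* A.toSubring.map (algebraMap K L) :=
    A.toSubring.equivMapOfInjective _ (algebraMap K L).injective
  -- Chevalley: some `B` dominates the image of `A`. Domination gives equality of the contraction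
  -- with `A`, since an element outside `A` has its inverse in the maximal ideal, hence among the
  -- nonunits of `B`.
  obtain ⟨B, h1, h2⟩ := Ideal.image_subset_nonunits_valuationSubring
    (((IsLocalRing.maximalIdeal A).map e)) (by
      intro h
      have := congrArg (Ideal.comap e) h
      rw [Ideal.comap_map_of_bijective _ e.bijective, Ideal.comap_top] at this
      exact Ideal.IsPrime.ne_top' this)
  refine ⟨B, ?_⟩
  ext z
  rw [mem_comap]
  constructor
  · intro hz
    by_contra hzA
    have h3 := inv_mem_of_notMem hzA
    have h4 : z⁻¹ ∈ A := (A.valuation_le_one_iff _).1 h3.le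
    have h5 : algebraMap K L z⁻¹ ∈ B.nonunits := by
      apply h2
      refine ⟨e ⟨z⁻¹, h4⟩, Ideal.mem_map_of_mem _ ((A.valuation_lt_one_iff _).2 h3), rfl⟩
    rw [map_inv₀, inv_mem_nonunits_iff] at h5
    rcases h5 with h5 | h5
    · rw [map_eq_zero] at h5
      exact hzA (h5 ▸ A.zero_mem)
    · exact h5 hz
  · intro hz
    exact h1 ⟨z, hz, rfl⟩

end ValuationSubring

/-! ### Artin–Schreier extensions in characteristic two -/

/-- `L = K(y)` is a separable quadratic extension of a field of characteristic two, given by the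
equation `y² + y = f`. -/
structure IsArtinSchreierGenerator {K L : Type*} [Field K] [Field L] [Algebra K L]
    (f : K) (y : L) : Prop where
  two_eq_zero : (2 : K) = 0
  equation : y ^ 2 + y = algebraMap K L f
  exists_repr : ∀ z : L, ∃ a b : K, z = algebraMap K L a + algebraMap K L b * y
  notMem : ∀ a : K, algebraMap K L a ≠ y

namespace IsArtinSchreierGenerator

variable {K L : Type*} [Field K] [Field L] [Algebra K L] {f : K} {y : L}

theorem two_eq_zero' (h : IsArtinSchreierGenerator f y) : (2 : L) = 0 := by
  have := congrArg (algebraMap K L) h.two_eq_zero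
  rwa [map_ofNat, map_zero] at this

theorem add (h : IsArtinSchreierGenerator f y) (g : K) :
    IsArtinSchreierGenerator (f + (g ^ 2 + g)) (y + algebraMap K L g) where
  two_eq_zero := h.two_eq_zero
  equation := by
    have := h.equation
    have := h.two_eq_zero'
    simp only [map_add, map_pow]
    grind
  exists_repr z := by
    obtain ⟨a, b, rfl⟩ := h.exists_repr z
    refine ⟨a - b * g, b, ?_⟩
    simp only [map_sub, map_mul]
    ring
  notMem a ha := h.notMem (a - g) (by rw [map_sub, ha]; ring)

theorem add_one (h : IsArtinSchreierGenerator f y) : IsArtinSchreierGenerator f (y + 1) := by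
  have h1 := h.add 1
  have h2 := h.two_eq_zero
  have h3 : f + (1 ^ 2 + 1) = f := by linear_combination h2
  rwa [h3, map_one] at h1

theorem repr_injective (h : IsArtinSchreierGenerator f y) {a b : K}
    (h0 : algebraMap K L a + algebraMap K L b * y = 0) : a = 0 ∧ b = 0 := by
  have hb : b = 0 := by
    by_contra hb
    apply h.notMem (-a / b)
    have : algebraMap K L b ≠ 0 := by simpa using hb
    rw [map_div₀, map_neg]
    field_simp
    linear_combination -h0
  subst hb
  simpa using h0

theorem finrank_eq (h : IsArtinSchreierGenerator f y) : Module.finrank K L = 2 := by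
  have hli : LinearIndependent K ![(1 : L), y] := by
    rw [LinearIndependent.pair_iff]
    intro s t hst
    apply h.repr_injective
    simpa [Algebra.smul_def] using hst
  have hsp : ⊤ ≤ Submodule.span K (Set.range ![(1 : L), y]) := by
    intro z _
    obtain ⟨a, b, rfl⟩ := h.exists_repr z
    rw [Matrix.range_cons, Matrix.range_cons, Matrix.range_empty, Set.union_empty,
      Set.singleton_union, Submodule.mem_span_pair]
    exact ⟨a, b, by simp [Algebra.smul_def]⟩
  have := Module.finrank_eq_card_basis (Module.Basis.mk hli hsp)
  simpa using this

/-- Replacing y by y + 1 respects y² + y = f in characteristic two. The conjugation is what produces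
the second place over a split place. -/
theorem exists_conj (h : IsArtinSchreierGenerator f y) : ∃ σ : L →ₐ[K] L, σ y = y + 1 := by
  have h2 := h.two_eq_zero'
  choose a b hab using h.exists_repr
  have huniq : ∀ a' b' : K, a (algebraMap K L a' + algebraMap K L b' * y) = a' ∧
      b (algebraMap K L a' + algebraMap K L b' * y) = b' := by
    intro a' b'
    have h1 := hab (algebraMap K L a' + algebraMap K L b' * y)
    have := h.repr_injective (a := a' - a (algebraMap K L a' + algebraMap K L b' * y))
      (b := b' - b (algebraMap K L a' + algebraMap K L b' * y))
      (by rw [map_sub, map_sub]; linear_combination h1)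
    exact ⟨(sub_eq_zero.1 this.1).symm, (sub_eq_zero.1 this.2).symm⟩
  have hval : ∀ (z : L) (a' b' : K), z = algebraMap K L a' + algebraMap K L b' * y →
      algebraMap K L (a z) + algebraMap K L (b z) * (y + 1) =
        algebraMap K L a' + algebraMap K L b' * (y + 1) := by
    rintro z a' b' rfl
    rw [(huniq a' b').1, (huniq a' b').2]
  let σ : L →+* L :=
    { toFun := fun z => algebraMap K L (a z) + algebraMap K L (b z) * (y + 1)
      map_one' := by rw [hval 1 1 0 (by simp)]; simp
      map_zero' := by rw [hval 0 0 0 (by simp)]; simp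
      map_add' := fun z w => by
        rw [hval (z + w) (a z + a w) (b z + b w)
          (by rw [map_add, map_add]; linear_combination hab z + hab w)]
        rw [map_add, map_add]; ring
      map_mul' := fun z w => by
        have e := h.equation
        rw [hval (z * w) (a z * a w + b z * b w * f) (a z * b w + a w * b z - b z * b w)
          (by
            simp only [map_add, map_mul, map_sub]
            rw [← e]
            linear_combination w * hab z +
              (algebraMap K L (a z) + algebraMap K L (b z) * y) * hab w)]
        simp only [map_add, map_mul, map_sub]
        rw [← e]
        linear_combination -(algebraMap K L (b z) * algebraMap K L (b w) * (y + 1)) * h2 }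
  refine ⟨{ σ with commutes' := fun r => ?_ }, ?_⟩
  · change algebraMap K L (a _) + algebraMap K L (b _) * (y + 1) = _
    rw [hval _ r 0 (by simp)]
    simp
  · change algebraMap K L (a _) + algebraMap K L (b _) * (y + 1) = _
    rw [hval _ 0 1 (by simp)]
    simp

end IsArtinSchreierGenerator

/-! ### Places of K(y) over a place where f vanishes -/

section

/-- The valuation ring `A` of `K` contains `F`, and `F` is its residue field. -/
structure IsRationalPlace (F : Type*) {K : Type*} [Field F] [Field K] [Algebra F K]
    (A : ValuationSubring K) : Prop where
  algebraMap_mem : ∀ c : F, algebraMap F K c ∈ A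
  exists_residue : ∀ z ∈ A, ∃ c : F, A.valuation (z - algebraMap F K c) < 1

namespace IsArtinSchreierGenerator

open ValuationSubring

variable {F K L : Type*} [Field F] [Field K] [Field L] [Algebra F K] [Algebra F L] [Algebra K L]
  [IsScalarTower F K L] {f : K} {y : L} {A : ValuationSubring K} {B : ValuationSubring L}

theorem valuation_eq_of_lt_one (h : IsArtinSchreierGenerator f y) (hB : B.valuation y < 1) :
    B.valuation y = B.valuation (algebraMap K L f) := by
  have h1 : B.valuation (1 + y) = 1 := by
    rw [Valuation.map_add_eq_of_lt_left] <;> simp [hB]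
  rw [← h.equation, show y ^ 2 + y = y * (1 + y) by ring, map_mul, h1, mul_one]

/-- Iterating y = f + y² gives y = f + f² + f⁴ + ⋯ up to an error y^(2^n), so y is a limit of
elements of K; this replaces Hensel's lemma and completions. The approximation does not depend on
`B`, which is what yields uniqueness of the place with y small. -/
theorem exists_approx (h : IsArtinSchreierGenerator f y) {t : K} (ht : A.IsUniformizer t)
    (hf : A.valuation f < 1) {c : K} (hc : c ≠ 0) (b : K) :
    ∃ y' : K, ∀ B : ValuationSubring L, B.comap (algebraMap K L) = A → B.valuation y < 1 →
      B.valuation (algebraMap K L b * (y - algebraMap K L y')) < B.valuation (algebraMap K L c) := by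
  have h2 := h.two_eq_zero'
  have hsum : ∀ n : ℕ, ∃ y' : K, y - algebraMap K L y' = y ^ (2 ^ n) := by
    intro n
    induction n with
    | zero => exact ⟨0, by simp⟩
    | succ n ih =>
      obtain ⟨y', hy'⟩ := ih
      refine ⟨f + y' ^ 2, ?_⟩
      rw [pow_succ 2 n, pow_mul, ← hy', map_add, map_pow, ← h.equation]
      linear_combination (-y ^ 2 + y * algebraMap K L y' - algebraMap K L y' ^ 2) * h2
  have hn : ∃ n : ℕ, A.valuation (b * f ^ (2 ^ n)) < A.valuation c := by
    by_cases hf0 : f = 0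
    · exact ⟨0, by simpa [hf0] using A.valuation_pos hc⟩
    by_cases hb0 : b = 0
    · exact ⟨0, by simpa [hb0] using A.valuation_pos hc⟩
    obtain ⟨k, hk⟩ := ht.2.2 (b / c) (div_ne_zero hb0 hc)
    obtain ⟨m, hm⟩ := ht.exists_nat hf0 ((A.valuation_le_one_iff _).1 hf.le)
    have hm0 : m ≠ 0 := by rintro rfl; rw [hm] at hf; simp at hf
    -- The exponent of b f^(2^n) / c is k + m·2^n with m ≥ 1, and it is positive for n = |k| because
    -- |k| < 2^|k|.
    refine ⟨k.natAbs, ?_⟩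
    have hpos := A.valuation_pos hc
    rw [← div_lt_one₀ hpos, ← map_div₀, mul_div_right_comm, map_mul, map_pow, hk, hm,
      ← pow_mul, ← zpow_natCast, ← zpow_add₀ ht.valuation_pos.ne']
    apply zpow_lt_one₀ ht.valuation_pos ht.2.1
    have h1 : k.natAbs < 2 ^ k.natAbs := Nat.lt_two_pow_self
    have h3 : 2 ^ k.natAbs ≤ m * 2 ^ k.natAbs := Nat.le_mul_of_pos_left _ (Nat.pos_of_ne_zero hm0)
    have h4 : (k.natAbs : ℤ) < (m * 2 ^ k.natAbs : ℕ) := by exact_mod_cast h1.trans_le h3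
    omega
  obtain ⟨n, hn⟩ := hn
  obtain ⟨y', hy'⟩ := hsum n
  refine ⟨y', fun B hB hy => ?_⟩
  rw [hy', map_mul, map_pow, h.valuation_eq_of_lt_one hy, ← map_pow, ← map_mul, ← map_pow,
    ← map_mul, valuation_algebraMap_lt_iff hB]
  exact hn

/-- The norm of z = a + by is z(z + b). If z is smaller than b, then its conjugate z + b has the
value of b, so z has the value of the element N(z)/b of K. -/
theorem exists_valuation_le (h : IsArtinSchreierGenerator f y) (B : ValuationSubring L) {z : L}
    (hz : z ≠ 0) : ∃ c : K, c ≠ 0 ∧ B.valuation (algebraMap K L c) ≤ B.valuation z := by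
  obtain ⟨a, b, hab⟩ := h.exists_repr z
  by_cases hb : b = 0
  · subst hb
    refine ⟨a, ?_, by rw [hab]; simp⟩
    rintro rfl
    simp [hab] at hz
  by_cases hle : B.valuation (algebraMap K L b) ≤ B.valuation z
  · exact ⟨b, hb, hle⟩
  push Not at hle
  have h2 := h.two_eq_zero'
  have hN : z * (z + algebraMap K L b) = algebraMap K L (a ^ 2 + a * b + b ^ 2 * f) := by
    simp only [map_add, map_mul, map_pow]
    rw [← h.equation, hab]
    linear_combination (algebraMap K L a * algebraMap K L b * y) * h2
  have hv : B.valuation (z + algebraMap K L b) = B.valuation (algebraMap K L b) :=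
    Valuation.map_add_eq_of_lt_right _ hle
  have hpos : 0 < B.valuation (algebraMap K L b) := B.valuation_pos (by simpa using hb)
  refine ⟨(a ^ 2 + a * b + b ^ 2 * f) / b, div_ne_zero (fun h0 => ?_) hb, ?_⟩
  · rw [h0, map_zero] at hN
    have := (mul_eq_zero.1 hN).resolve_left hz
    rw [this, map_zero] at hv
    exact hpos.ne hv
  · rw [map_div₀, map_div₀, ← hN, map_mul, hv, mul_div_cancel_right₀ _ hpos.ne']

/-- Every element of L has the leading term of an element of K. Hence the extension is immediate:
value group and residue field do not grow. -/
theorem exists_valuation_sub_lt (h : IsArtinSchreierGenerator f y) {t : K}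
    (ht : A.IsUniformizer t) (hf : A.valuation f < 1) (hB : B.comap (algebraMap K L) = A)
    (hy : B.valuation y < 1) {z : L} (hz : z ≠ 0) :
    ∃ a : K, B.valuation (z - algebraMap K L a) < B.valuation z := by
  obtain ⟨c, hc, hcz⟩ := h.exists_valuation_le B hz
  obtain ⟨a, b, rfl⟩ := h.exists_repr z
  obtain ⟨y', hy'⟩ := h.exists_approx ht hf hc b
  refine ⟨a + b * y', lt_of_lt_of_le ?_ hcz⟩
  convert hy' B hB hy using 2
  simp only [map_add, map_mul]
  ring

theorem isUniformizer_algebraMap (h : IsArtinSchreierGenerator f y) {t : K}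
    (ht : A.IsUniformizer t) (hf : A.valuation f < 1) (hB : B.comap (algebraMap K L) = A)
    (hy : B.valuation y < 1) {s : K} (hs : A.IsUniformizer s) :
    B.IsUniformizer (algebraMap K L s) := by
  refine ⟨by simpa using hs.1, (valuation_algebraMap_lt_one_iff hB s).2 hs.2.1, fun z hz => ?_⟩
  obtain ⟨a, ha⟩ := h.exists_valuation_sub_lt ht hf hB hy hz
  have hv : B.valuation (algebraMap K L a) = B.valuation z := by
    rw [Valuation.map_sub_swap] at ha
    have := Valuation.map_add_eq_of_lt_right _ ha
    rwa [sub_add_cancel] at this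
  have ha0 : a ≠ 0 := by
    rintro rfl
    rw [map_zero, map_zero] at hv
    exact (B.valuation_pos hz).ne hv
  rw [← hv]
  exact hs.valuation_algebraMap hB ha0

theorem isRationalPlace_of_lt_one (h : IsArtinSchreierGenerator f y) {t : K}
    (ht : A.IsUniformizer t) (hf : A.valuation f < 1) (hB : B.comap (algebraMap K L) = A)
    (hy : B.valuation y < 1) (hA : IsRationalPlace F A) : IsRationalPlace F B := by
  refine ⟨fun c => ?_, fun z hz => ?_⟩
  · rw [IsScalarTower.algebraMap_apply F K L, algebraMap_mem_iff hB]
    exact hA.algebraMap_mem c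
  · by_cases hz0 : z = 0
    · exact ⟨0, by simp [hz0]⟩
    obtain ⟨a, ha⟩ := h.exists_valuation_sub_lt ht hf hB hy hz0
    have hza : B.valuation (z - algebraMap K L a) < 1 :=
      ha.trans_le ((B.valuation_le_one_iff z).2 hz)
    have haA : a ∈ A := by
      rw [← algebraMap_mem_iff hB]
      have := B.sub_mem hz ((B.valuation_le_one_iff _).1 hza.le)
      rwa [sub_sub_cancel] at this
    obtain ⟨c, hc⟩ := hA.exists_residue a haA
    refine ⟨c, ?_⟩
    rw [← valuation_algebraMap_lt_one_iff hB, map_sub, ← IsScalarTower.algebraMap_apply] at hc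
    have := Valuation.map_add_lt _ hza hc
    rwa [sub_add_sub_cancel] at this

/-- With w ∈ K close to y, membership of a + by is membership of a + bw in `A`, a condition that
does not mention the place above. -/
theorem eq_of_valuation_lt_one (h : IsArtinSchreierGenerator f y) {t : K}
    (ht : A.IsUniformizer t) (hf : A.valuation f < 1) {B' : ValuationSubring L}
    (hB : B.comap (algebraMap K L) = A) (hB' : B'.comap (algebraMap K L) = A)
    (hy : B.valuation y < 1) (hy' : B'.valuation y < 1) : B = B' := by
  ext z
  obtain ⟨a, b, rfl⟩ := h.exists_repr z
  obtain ⟨w, hw⟩ := h.exists_approx ht hf one_ne_zero b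
  have key : ∀ C : ValuationSubring L, C.comap (algebraMap K L) = A → C.valuation y < 1 →
      (algebraMap K L a + algebraMap K L b * y ∈ C ↔ a + b * w ∈ A) := by
    intro C hC hyC
    have h1 := hw C hC hyC
    rw [map_one, map_one] at h1
    have h2 := (C.valuation_le_one_iff _).1 h1.le
    rw [← algebraMap_mem_iff hC]
    have h3 : algebraMap K L a + algebraMap K L b * y = algebraMap K L (a + b * w) +
      algebraMap K L b * (y - algebraMap K L w) := by
      simp only [map_add, map_mul]; ring
    rw [h3]
    exact ⟨fun h4 => by simpa using C.sub_mem h4 h2, fun h4 => C.add_mem _ _ h4 h2⟩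
  rw [key B hB hy, key B' hB' hy']

theorem lt_one_or_lt_one (h : IsArtinSchreierGenerator f y) (hf : A.valuation f < 1)
    (hB : B.comap (algebraMap K L) = A) : B.valuation y < 1 ∨ B.valuation (y + 1) < 1 := by
  have h1 : B.valuation y * B.valuation (y + 1) < 1 := by
    rw [← map_mul, show y * (y + 1) = y ^ 2 + y by ring, h.equation,
      valuation_algebraMap_lt_one_iff hB]
    exact hf
  by_contra! h3
  exact absurd h1 (not_lt.2 (one_le_mul_of_one_le_of_one_le h3.1 h3.2))

/-- A place where `f` vanishes has exactly two extensions to `K(y)`, `y² + y = f`. -/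
theorem exists_split (h : IsArtinSchreierGenerator f y) {t : K} (ht : A.IsUniformizer t)
    (hf : A.valuation f < 1) : ∃ B₁ B₂ : ValuationSubring L,
      B₁.comap (algebraMap K L) = A ∧ B₂.comap (algebraMap K L) = A ∧ B₁ ≠ B₂ ∧
      B₁.valuation y < 1 ∧ B₂.valuation (y + 1) < 1 ∧
      ∀ B : ValuationSubring L, B.comap (algebraMap K L) = A → B = B₁ ∨ B = B₂ := by
  obtain ⟨σ, hσ⟩ := h.exists_conj
  have h2 := h.two_eq_zero'
  have hσ' : σ (y + 1) = y := by rw [map_add, hσ, map_one]; linear_combination h2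
  have hcomap : ∀ B : ValuationSubring L, B.comap (algebraMap K L) = A →
      (B.comap σ.toRingHom).comap (algebraMap K L) = A := by
    intro B hB
    rw [comap_comap, ← hB]
    congr 1
    ext z
    simp
  have hval : ∀ (B : ValuationSubring L) (z : L), B.valuation (σ z) < 1 →
      (B.comap σ.toRingHom).valuation z < 1 := by
    intro B z hz
    rw [← ValuationSubring.mem_nonunits_iff, mem_nonunits_iff_or] at hz ⊢
    refine hz.imp (fun h0 => by simpa using h0) fun h0 h1 => h0 ?_
    rw [← map_inv₀]
    exact h1
  have hex : ∃ B₁ : ValuationSubring L, B₁.comap (algebraMap K L) = A ∧ B₁.valuation y < 1 := by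
    obtain ⟨B, hB⟩ := exists_comap_eq L A
    rcases h.lt_one_or_lt_one hf hB with h1 | h1
    · exact ⟨B, hB, h1⟩
    · exact ⟨_, hcomap B hB, hval B y (by rwa [hσ])⟩
  obtain ⟨B₁, hB₁, hy₁⟩ := hex
  -- The second place is the conjugate of the first. They differ because y and y + 1 cannot both be
  -- small.
  have hB₂ := hcomap B₁ hB₁
  have hy₂ := hval B₁ (y + 1) (by rwa [hσ'])
  refine ⟨B₁, _, hB₁, hB₂, ?_, hy₁, hy₂, fun B hB => ?_⟩
  · intro heq
    rw [← heq] at hy₂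
    have := Valuation.map_sub_lt _ hy₂ hy₁
    simp at this
  · rcases h.lt_one_or_lt_one hf hB with h1 | h1
    · exact Or.inl (h.eq_of_valuation_lt_one ht hf hB hB₁ h1 hy₁)
    · exact Or.inr (h.add_one.eq_of_valuation_lt_one ht hf hB hB₂ h1 hy₂)

/-! ### Places of K(y) over a simple pole of f -/

section Ramified

/-- At a pole the term z² dominates z. Stated only modulo regular functions, so that it also applies
to approximate solutions z. -/
theorem valuation_sq_eq {z : L} {g : K} (hg : g ∉ A) (hB : B.comap (algebraMap K L) = A)
    (hz : z ^ 2 + z - algebraMap K L g ∈ B) :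
    B.valuation z ^ 2 = B.valuation (algebraMap K L g) ∧ 1 < B.valuation z := by
  have hg' : 1 < B.valuation (algebraMap K L g) := by
    rw [← not_le, B.valuation_le_one_iff, algebraMap_mem_iff hB]; exact hg
  have h1 : B.valuation (z ^ 2 + z) = B.valuation (algebraMap K L g) := by
    have := Valuation.map_add_eq_of_lt_right B.valuation
      (((B.valuation_le_one_iff _).2 hz).trans_lt hg')
    rwa [sub_add_cancel] at this
  have hz1 : 1 < B.valuation z := by
    by_contra h3
    rw [not_lt, B.valuation_le_one_iff] at h3
    have h4 := (B.valuation_le_one_iff _).2 (B.add_mem _ _ (pow_mem h3 2) h3)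
    rw [h1] at h4
    exact absurd hg' (not_lt.2 h4)
  refine ⟨?_, hz1⟩
  rw [← h1, ← map_pow, Valuation.map_add_eq_of_lt_left]
  rw [map_pow]
  exact lt_self_pow₀ hz1 one_lt_two

theorem notMem_of_isUniformizer_inv {g : K} (hg : A.IsUniformizer g⁻¹) : g ∉ A := by
  intro h
  have h1 := hg.2.1
  rw [map_inv₀, inv_lt_one_iff₀] at h1
  rcases h1 with h1 | h1
  · exact absurd (A.valuation_pos fun h0 => hg.1 (by rw [h0, inv_zero])) (not_lt.2 h1)
  · exact absurd ((A.valuation_le_one_iff g).2 h) (not_le.2 h1)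

variable (h : IsArtinSchreierGenerator f y) (hf : A.IsUniformizer f⁻¹)
  (hB : B.comap (algebraMap K L) = A)

include h hf hB

/-- In units of the value of y⁻¹, nonzero elements of K have even exponents and their multiples by y
odd ones. So the two terms of a + by never cancel, and the value of the sum is the larger of the
two. -/
theorem valuation_repr (a b : K) :
    (algebraMap K L a + algebraMap K L b * y ∈ B ↔ a ∈ A ∧ B.valuation (algebraMap K L b * y) < 1) ∧
    (a ≠ 0 ∨ b ≠ 0 → ∃ n : ℤ, B.valuation (algebraMap K L a + algebraMap K L b * y) =
      B.valuation y⁻¹ ^ n) := by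
  obtain ⟨h1, h2⟩ := valuation_sq_eq (notMem_of_isUniformizer_inv hf) hB
    (z := y) (by rw [h.equation, sub_self]; exact B.zero_mem)
  have hγ1 : B.valuation y⁻¹ < 1 := by rw [map_inv₀]; exact inv_lt_one_of_one_lt₀ h2
  have hγ0 : 0 < B.valuation y⁻¹ := by
    apply B.valuation_pos
    rw [Ne, inv_eq_zero]
    rintro rfl
    exact h.notMem 0 (map_zero _)
  set γ := B.valuation y⁻¹ with hγ
  have hy : B.valuation y = γ ^ (-1 : ℤ) := by rw [hγ, map_inv₀]; simp
  have hfγ : B.valuation (algebraMap K L f⁻¹) = γ ^ (2 : ℤ) := by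
    rw [map_inv₀, map_inv₀, ← h1, hγ, map_inv₀, ← inv_pow]; norm_cast
  have hK : ∀ c : K, c ≠ 0 → ∃ n : ℤ, B.valuation (algebraMap K L c) = γ ^ (2 * n) := by
    intro c hc
    obtain ⟨n, hn⟩ := hf.valuation_algebraMap hB hc
    exact ⟨n, by rw [hn, hfγ, zpow_mul]⟩
  have hKy : ∀ c : K, c ≠ 0 → ∃ n : ℤ, B.valuation (algebraMap K L c * y) = γ ^ (2 * n - 1) := by
    intro c hc
    obtain ⟨n, hn⟩ := hK c hc
    exact ⟨n, by rw [map_mul, hn, hy, ← zpow_add₀ hγ0.ne']; rfl⟩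
  have hinj := zpow_right_injective₀ hγ0 hγ1.ne
  have hlt : ∀ c : K, B.valuation (algebraMap K L c * y) ≤ 1 →
      B.valuation (algebraMap K L c * y) < 1 := by
    intro c hc
    refine lt_of_le_of_ne hc fun heq => ?_
    by_cases hc0 : c = 0
    · simp [hc0] at heq
    obtain ⟨n, hn⟩ := hKy c hc0
    rw [hn] at heq
    have : (2 * n - 1 : ℤ) = 0 := hinj (by simpa using heq)
    omega
  have hmax : B.valuation (algebraMap K L a + algebraMap K L b * y) =
      max (B.valuation (algebraMap K L a)) (B.valuation (algebraMap K L b * y)) := by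
    by_cases ha0 : a = 0
    · simp [ha0]
    by_cases hb0 : b = 0
    · simp [hb0]
    apply Valuation.map_add_of_distinct_val
    obtain ⟨n, hn⟩ := hK a ha0
    obtain ⟨m, hm⟩ := hKy b hb0
    rw [hn, hm]
    intro heq
    have : (2 * n : ℤ) = 2 * m - 1 := hinj heq
    omega
  constructor
  · rw [← B.valuation_le_one_iff, hmax, max_le_iff, B.valuation_le_one_iff,
      algebraMap_mem_iff hB]
    exact and_congr_right fun _ => ⟨hlt b, le_of_lt⟩
  · intro hab
    rw [hmax]
    by_cases ha0 : a = 0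
    · obtain ⟨m, hm⟩ := hKy b (hab.resolve_left (not_not.2 ha0))
      exact ⟨2 * m - 1, by rw [← hm]; simp [ha0]⟩
    by_cases hb0 : b = 0
    · obtain ⟨m, hm⟩ := hK a ha0
      exact ⟨2 * m, by rw [← hm]; simp [hb0]⟩
    rcases max_choice (B.valuation (algebraMap K L a)) (B.valuation (algebraMap K L b * y)) with
      h3 | h3 <;> rw [h3]
    · obtain ⟨m, hm⟩ := hK a ha0
      exact ⟨_, hm⟩
    · obtain ⟨m, hm⟩ := hKy b hb0
      exact ⟨_, hm⟩

theorem isUniformizer_inv : B.IsUniformizer y⁻¹ := by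
  have hy0 : y ≠ 0 := by
    rintro rfl
    exact h.notMem 0 (map_zero _)
  obtain ⟨h1, h2⟩ := valuation_sq_eq (notMem_of_isUniformizer_inv hf) hB
    (z := y) (by rw [h.equation, sub_self]; exact B.zero_mem)
  refine ⟨inv_ne_zero hy0, by rw [map_inv₀]; exact inv_lt_one_of_one_lt₀ h2, fun z hz => ?_⟩
  obtain ⟨a, b, rfl⟩ := h.exists_repr z
  refine (h.valuation_repr hf hB a b).2 ?_
  by_contra! h0
  simp [h0] at hz

/-- g and f are both simple poles, so z and y have equal squared values. This is the base case for
turning pole chains into dual chains. -/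
theorem isUniformizer_inv_of_sub_mem {g : K} (hg : A.IsUniformizer g⁻¹) {z : L}
    (hz : z ^ 2 + z - algebraMap K L g ∈ B) : B.IsUniformizer z⁻¹ := by
  obtain ⟨h1, h2⟩ := valuation_sq_eq (notMem_of_isUniformizer_inv hf) hB
    (z := y) (by rw [h.equation, sub_self]; exact B.zero_mem)
  obtain ⟨h3, h4⟩ := valuation_sq_eq (notMem_of_isUniformizer_inv hg) hB hz
  refine (h.isUniformizer_inv hf hB).congr ?_
  have h5 : B.valuation (algebraMap K L g) = B.valuation (algebraMap K L f) := by
    rw [valuation_algebraMap_eq_iff hB]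
    have h6 := hf.maximalIdeal_eq
    have h7 := hg.maximalIdeal_eq
    rw [h6, Ideal.span_singleton_eq_span_singleton] at h7
    obtain ⟨u, hu⟩ := h7
    have h8 : A.valuation f⁻¹ = A.valuation g⁻¹ := by
      have h9 : f⁻¹ * ((u : A) : K) = g⁻¹ := congrArg Subtype.val hu
      rw [← h9, map_mul, A.valuation_unit, mul_one]
    rw [map_inv₀, map_inv₀, inv_inj] at h8
    exact h8.symm
  rw [h5, ← h1] at h3
  rw [map_inv₀, map_inv₀, (pow_left_inj₀ zero_le zero_le two_ne_zero).1 h3]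

theorem isRationalPlace_of_ramified (hA : IsRationalPlace F A) : IsRationalPlace F B := by
  refine ⟨fun c => ?_, fun z hz => ?_⟩
  · rw [IsScalarTower.algebraMap_apply F K L, algebraMap_mem_iff hB]
    exact hA.algebraMap_mem c
  · obtain ⟨a, b, rfl⟩ := h.exists_repr z
    obtain ⟨ha, hb⟩ := (h.valuation_repr hf hB a b).1.1 hz
    obtain ⟨c, hc⟩ := hA.exists_residue a ha
    refine ⟨c, ?_⟩
    rw [← valuation_algebraMap_lt_one_iff hB, map_sub, ← IsScalarTower.algebraMap_apply] at hc
    have := Valuation.map_add_lt _ hc hb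
    convert this using 2
    ring

/-- By `valuation_repr`, membership of a + by means that a is in `A` and by is small; the latter
says that b²f is small, which is decided in `A`. -/
theorem eq_of_ramified {B' : ValuationSubring L} (hB' : B'.comap (algebraMap K L) = A) :
    B = B' := by
  ext z
  obtain ⟨a, b, rfl⟩ := h.exists_repr z
  have key : ∀ C : ValuationSubring L, C.comap (algebraMap K L) = A →
      (C.valuation (algebraMap K L b * y) < 1 ↔ A.valuation (b ^ 2 * f) < 1) := by
    intro C hC
    obtain ⟨h1, h2⟩ := valuation_sq_eq (notMem_of_isUniformizer_inv hf) hC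
      (z := y) (by rw [h.equation, sub_self]; exact C.zero_mem)
    rw [← valuation_algebraMap_lt_one_iff hC, map_mul, map_mul, map_mul, ← h1, map_pow, map_pow,
      ← mul_pow, pow_lt_one_iff_of_nonneg zero_le two_ne_zero]
  rw [(h.valuation_repr hf hB a b).1, (h.valuation_repr hf hB' a b).1, key B hB, key B' hB']

end Ramified

end IsArtinSchreierGenerator

end

/-! ### Pole chains and their behaviour in Artin–Schreier extensions -/

section

open ValuationSubring

variable {F K L : Type*} [Field F] [Field K] [Field L] [Algebra F K] [Algebra F L] [Algebra K L]
  [IsScalarTower F K L] {A : ValuationSubring K} {B : ValuationSubring L}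

/-- A function `y` whose pole at `A` is reduced to a simple pole in `m` steps
`y ≡ ω (r² + r)` modulo functions regular at `A`, where `ω` is a primitive cube root of unity. -/
inductive PoleChain (F : Type*) {K : Type*} [Field F] [Field K] [Algebra F K]
    (A : ValuationSubring K) : ℕ → K → Prop
  | simple {y : K} : A.IsUniformizer y⁻¹ → PoleChain F A 0 y
  | step {m : ℕ} {y r : K} (ω : F) : ω ^ 2 + ω + 1 = 0 → PoleChain F A m r →
      y - algebraMap F K ω * (r ^ 2 + r) ∈ A → PoleChain F A (m + 1) y

/-- A function `y` whose pole at `A` is reduced to a simple pole in `m` steps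
`y ≡ (ω r)² + ω r` modulo functions regular at `A`, where `ω` is a primitive cube root of unity. -/
inductive DualPoleChain (F : Type*) {K : Type*} [Field F] [Field K] [Algebra F K]
    (A : ValuationSubring K) : ℕ → K → Prop
  | simple {y : K} : A.IsUniformizer y⁻¹ → DualPoleChain F A 0 y
  | step {m : ℕ} {y r : K} (ω : F) : ω ^ 2 + ω + 1 = 0 → DualPoleChain F A m r →
      y - ((algebraMap F K ω * r) ^ 2 + algebraMap F K ω * r) ∈ A → DualPoleChain F A (m + 1) y

theorem ValuationSubring.IsUniformizer.inv_congr {y y' : K} (h : A.IsUniformizer y⁻¹)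
    (hy : y' - y ∈ A) : A.IsUniformizer y'⁻¹ := by
  have h1 := IsArtinSchreierGenerator.notMem_of_isUniformizer_inv h
  rw [← A.valuation_le_one_iff, not_le] at h1
  refine h.congr ?_
  have := Valuation.map_add_eq_of_lt_right A.valuation
    (((A.valuation_le_one_iff _).2 hy).trans_lt h1)
  rw [sub_add_cancel] at this
  rw [map_inv₀, map_inv₀, this]

theorem ValuationSubring.mem_of_sq_add_self_mem {z : K} (h : z ^ 2 + z ∈ A) : z ∈ A := by
  rcases A.mem_or_inv_mem z with h1 | h1
  · exact h1
  · by_cases h0 : z = 0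
    · exact h0 ▸ A.zero_mem
    have h2 := A.sub_mem (A.mul_mem _ _ h h1) A.one_mem
    have h3 : (z ^ 2 + z) * z⁻¹ - 1 = z := by field_simp; ring
    rwa [h3] at h2

theorem ne_zero_of_cube_root {ω : F} (h : ω ^ 2 + ω + 1 = 0) : ω ≠ 0 := by
  rintro rfl
  simp at h

theorem PoleChain.congr {m : ℕ} {y y' : K} (h : PoleChain F A m y) (hy : y' - y ∈ A) :
    PoleChain F A m y' := by
  cases h with
  | simple h1 => exact .simple (h1.inv_congr hy)
  | step ω hω hr h1 => exact .step ω hω hr (by simpa using A.add_mem _ _ hy h1)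

theorem ValuationSubring.mem_of_algebraMap_mul_mem (hA : ∀ c : F, algebraMap F K c ∈ A) {c : F}
    (hc : c ≠ 0) {z : K} (h : algebraMap F K c * z ∈ A) : z ∈ A := by
  have h1 := A.mul_mem _ _ (hA c⁻¹) h
  rwa [← mul_assoc, ← map_mul, inv_mul_cancel₀ hc, map_one, one_mul] at h1

theorem ValuationSubring.valuation_algebraMap_eq_one (hA : ∀ c : F, algebraMap F K c ∈ A) {c : F}
    (hc : c ≠ 0) : A.valuation (algebraMap F K c) = 1 := by
  apply le_antisymm ((A.valuation_le_one_iff _).2 (hA c))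
  have := (A.valuation_le_one_iff _).2 (hA c⁻¹)
  rw [map_inv₀, map_inv₀] at this
  exact (inv_le_one₀ (A.valuation_pos (by simpa using hc))).1 this

theorem PoleChain.notMem (hA : ∀ c : F, algebraMap F K c ∈ A) {m : ℕ} {y : K}
    (h : PoleChain F A m y) : y ∉ A := by
  induction h with
  | simple h1 => exact IsArtinSchreierGenerator.notMem_of_isUniformizer_inv h1
  | step ω hω hr h1 ih =>
    intro hy
    apply ih
    have h2 := A.sub_mem hy h1
    rw [sub_sub_cancel] at h2
    exact mem_of_sq_add_self_mem (mem_of_algebraMap_mul_mem hA (ne_zero_of_cube_root hω) h2)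

theorem DualPoleChain.notMem (hA : ∀ c : F, algebraMap F K c ∈ A) {m : ℕ} {y : K}
    (h : DualPoleChain F A m y) : y ∉ A := by
  induction h with
  | simple h1 => exact IsArtinSchreierGenerator.notMem_of_isUniformizer_inv h1
  | step ω hω hr h1 ih =>
    intro hy
    apply ih
    have h2 := A.sub_mem hy h1
    rw [sub_sub_cancel] at h2
    exact mem_of_algebraMap_mul_mem hA (ne_zero_of_cube_root hω) (mem_of_sq_add_self_mem h2)

/-- Pole chains persist in extensions that are unramified at `B`. -/
theorem PoleChain.map (hB : B.comap (algebraMap K L) = A)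
    (hu : ∀ s, A.IsUniformizer s → B.IsUniformizer (algebraMap K L s)) {m : ℕ} {y : K}
    (h : PoleChain F A m y) : PoleChain F B m (algebraMap K L y) := by
  induction h with
  | simple h1 => exact .simple (by rw [← map_inv₀]; exact hu _ h1)
  | step ω hω hr h1 ih =>
    refine .step ω hω ih ?_
    rw [← algebraMap_mem_iff hB] at h1
    simpa [← IsScalarTower.algebraMap_apply] using h1

/-- If z² + z ≡ ω(r² + r), put s = z + ω²r. Since ω(r² + r) = ℘(ω²r) + r, one has s² + s ≡ r, and
induction applies to s; eliminating r gives z ≡ s + ω²(s² + s) = (ωs)² + ωs. -/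
theorem PoleChain.dual_of_ramified (h2 : (2 : L) = 0) (hB : B.comap (algebraMap K L) = A)
    (hA : ∀ c : F, algebraMap F K c ∈ A)
    (hr : ∀ (g : K) (z : L), A.IsUniformizer g⁻¹ → z ^ 2 + z - algebraMap K L g ∈ B →
      B.IsUniformizer z⁻¹) {m : ℕ} {y : K} (h : PoleChain F A m y) {z : L}
    (hz : z ^ 2 + z - algebraMap K L y ∈ B) : DualPoleChain F B m z := by
  induction h generalizing z with
  | simple h1 => exact .simple (hr _ _ h1 hz)
  | @step m y r ω hω hr h1 ih =>
    rw [← algebraMap_mem_iff hB] at h1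
    simp only [map_sub, map_mul, map_add, map_pow, ← IsScalarTower.algebraMap_apply] at h1
    have hω' := congrArg (algebraMap F L) hω
    simp only [map_add, map_pow, map_one, map_zero] at hω'
    have hωB : algebraMap F L ω ∈ B := by
      rw [IsScalarTower.algebraMap_apply F K L, algebraMap_mem_iff hB]; exact hA ω
    set w := algebraMap F L ω
    set s := algebraMap K L r
    have h3 := B.add_mem _ _ hz h1
    refine .step (r := z + w ^ 2 * s) ω hω (ih ?_) ?_
    · convert h3 using 1
      grind
    · have h4 := B.mul_mem _ _ (pow_mem hωB 2) h3
      convert h4 using 1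
      change z - ((w * _) ^ 2 + w * _) = _
      grind

/-- If y ≡ ℘(ω'r), then ωy ≡ ω℘(ω'r), and by induction ω'r is itself a pole chain. The cube root may
change from step to step. -/
theorem DualPoleChain.poleChain_mul (hA : ∀ c : F, algebraMap F K c ∈ A) {m : ℕ} {y : K}
    (h : DualPoleChain F A m y) {ω : F} (hω : ω ^ 2 + ω + 1 = 0) :
    PoleChain F A m (algebraMap F K ω * y) := by
  induction h generalizing ω with
  | @simple y h1 =>
    refine .simple (h1.congr ?_)
    have h0 := ne_zero_of_cube_root hω
    have h3 := valuation_algebraMap_eq_one hA h0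
    rw [mul_inv, map_mul, map_inv₀, h3, inv_one, one_mul]
  | @step m y r ω' hω' hr h1 ih =>
    refine .step ω hω (ih hω') ?_
    rw [← mul_sub]
    exact A.mul_mem _ _ (hA ω) h1

/-- A dual chain of positive length is ℘(g) up to regular functions, which forces splitting one
level up; there the new coordinate is g up to regular functions, so its pole chain is known too. -/
theorem DualPoleChain.exists_poleChain (hA : ∀ c : F, algebraMap F K c ∈ A) {m : ℕ} {y : K}
    (h : DualPoleChain F A (m + 1) y) : ∃ g, PoleChain F A m g ∧ y - (g ^ 2 + g) ∈ A := by
  cases h with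
  | step ω hω hr h1 => exact ⟨_, hr.poleChain_mul hA hω, h1⟩

/-- Each step ω(r² + r) = ℘(ω²r) + r removes one layer modulo ℘, until the simple pole remains. This
is why a pole chain of any length forces ramification. -/
theorem PoleChain.exists_isUniformizer_inv (h2 : (2 : K) = 0) {m : ℕ} {y : K}
    (h : PoleChain F A m y) :
    ∃ g, A.IsUniformizer (y + (g ^ 2 + g))⁻¹ := by
  induction h with
  | simple h1 => exact ⟨0, by simpa using h1⟩
  | @step m y r ω hω hr h1 ih =>
    obtain ⟨g, hg⟩ := ih
    have hω' := congrArg (algebraMap F K) hω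
    simp only [map_add, map_pow, map_one, map_zero] at hω'
    set w := algebraMap F K ω
    refine ⟨g + w ^ 2 * r, hg.inv_congr ?_⟩
    convert h1 using 1
    grind

/-- A place where `f` vanishes has exactly two extensions to `K(y)`, `y² + y = f`, and is
unramified there. -/
theorem IsArtinSchreierGenerator.exists_split_unramified {f : K} {y : L}
    (h : IsArtinSchreierGenerator f y) {t : K} (ht : A.IsUniformizer t)
    (hA : IsRationalPlace F A) (hf : A.valuation f < 1) :
    ∃ B₁ B₂ : ValuationSubring L,
      B₁.comap (algebraMap K L) = A ∧ B₂.comap (algebraMap K L) = A ∧ B₁ ≠ B₂ ∧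
      B₁.valuation y < 1 ∧ B₂.valuation (y + 1) < 1 ∧
      (∀ B : ValuationSubring L, B.comap (algebraMap K L) = A → B = B₁ ∨ B = B₂) ∧
      ∀ B : ValuationSubring L, B.comap (algebraMap K L) = A →
        IsRationalPlace F B ∧
        ∀ s, A.IsUniformizer s → B.IsUniformizer (algebraMap K L s) := by
  obtain ⟨B₁, B₂, hB₁, hB₂, hne, hy₁, hy₂, hall⟩ := h.exists_split ht hf
  refine ⟨B₁, B₂, hB₁, hB₂, hne, hy₁, hy₂, hall, fun B hB => ?_⟩
  rcases h.lt_one_or_lt_one hf hB with h3 | h3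
  · exact ⟨h.isRationalPlace_of_lt_one ht hf hB h3 hA,
      fun s hs => h.isUniformizer_algebraMap ht hf hB h3 hs⟩
  · exact ⟨h.add_one.isRationalPlace_of_lt_one ht hf hB h3 hA,
      fun s hs => h.add_one.isUniformizer_algebraMap ht hf hB h3 hs⟩

/-- A place where `f` has the form `g² + g` up to a regular function has exactly two extensions
to `K(y)`, `y² + y = f`, and is unramified there. -/
theorem IsArtinSchreierGenerator.exists_split_of_sub_mem [IsAlgClosed F] {f : K} {y : L}
    (h : IsArtinSchreierGenerator f y) {t : K} (ht : A.IsUniformizer t)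
    (hA : IsRationalPlace F A) (g : K) (hg : f - (g ^ 2 + g) ∈ A) :
    ∃ (c : F) (B₁ B₂ : ValuationSubring L),
      B₁.comap (algebraMap K L) = A ∧ B₂.comap (algebraMap K L) = A ∧ B₁ ≠ B₂ ∧
      B₁.valuation (y - algebraMap K L g - algebraMap F L c) < 1 ∧
      B₂.valuation (y - algebraMap K L g - algebraMap F L c - 1) < 1 ∧
      (∀ B : ValuationSubring L, B.comap (algebraMap K L) = A → B = B₁ ∨ B = B₂) ∧
      ∀ B : ValuationSubring L, B.comap (algebraMap K L) = A →
        IsRationalPlace F B ∧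
        ∀ s, A.IsUniformizer s → B.IsUniformizer (algebraMap K L s) := by
  obtain ⟨e, he⟩ := hA.exists_residue _ hg
  -- Over the algebraically closed residue field the residue e of f − ℘(g) is ℘(c). Shifting y by g
  -- + c then makes the right-hand side vanish at the place.
  obtain ⟨c, hc⟩ : ∃ c : F, c ^ 2 + c = e := by
    have hd : (Polynomial.X ^ 2 + Polynomial.X - Polynomial.C e).degree ≠ 0 := by
      have : (Polynomial.X ^ 2 + Polynomial.X - Polynomial.C e).degree = 2 := by
        compute_degree!
      rw [this]
      decide
    obtain ⟨c, hc⟩ := IsAlgClosed.exists_root _ hd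
    exact ⟨c, by simpa [Polynomial.IsRoot, sub_eq_zero] using hc⟩
  have h2 := h.two_eq_zero
  have h2' := h.two_eq_zero'
  have h1 := h.add (g + algebraMap F K c)
  have hf : A.valuation (f + ((g + algebraMap F K c) ^ 2 + (g + algebraMap F K c))) < 1 := by
    convert he using 2
    rw [← hc, map_add, map_pow]
    grind
  have hy : y + algebraMap K L (g + algebraMap F K c) =
      y - algebraMap K L g - algebraMap F L c := by
    rw [map_add, ← IsScalarTower.algebraMap_apply]
    grind
  have hy1 : y + algebraMap K L (g + algebraMap F K c) + 1 =
      y - algebraMap K L g - algebraMap F L c - 1 := by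
    rw [hy]
    grind
  obtain ⟨B₁, B₂, hB₁, hB₂, hne, hy₁, hy₂, hu⟩ := h1.exists_split_unramified ht hA hf
  exact ⟨c, B₁, B₂, hB₁, hB₂, hne, hy ▸ hy₁, hy1 ▸ hy₂, hu⟩

end

/-! ### Types of places and how they propagate up the tower -/

section

open ValuationSubring

variable {F K L : Type*} [Field F] [Field K] [Field L] [Algebra F K] [Algebra F L] [Algebra K L]
  [IsScalarTower F K L] {A : ValuationSubring K} {B : ValuationSubring L}

/-- The possible behaviours of the coordinate `x_i` at a point of `C_i`. -/
inductive PlaceType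
  | ramified (m : ℕ)
  | unramifiedPole (m : ℕ)
  | one (m : ℕ)
  | cubeRoot (m : ℕ)
  | generic

/-- The coordinate `x` has type `τ` at the place `A`. -/
def HasPlaceType (F : Type*) {K : Type*} [Field F] [Field K] [Algebra F K]
    (A : ValuationSubring K) (x : K) : PlaceType → Prop
  | .ramified m => PoleChain F A m (x + 1 + 1 / x)
  | .unramifiedPole m => DualPoleChain F A (m + 1) x
  | .one m => PoleChain F A m (1 / (x + 1))
  | .cubeRoot m => ∃ ω : F, ω ^ 2 + ω + 1 = 0 ∧
      PoleChain F A m (algebraMap F K ω / (x + algebraMap F K ω))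
  | .generic => A.valuation x = 1 ∧ A.valuation (x + 1) = 1 ∧ A.valuation (x ^ 2 + x + 1) = 1

/-- The place `A` of `K` is unramified in `L`, and its extensions to `L` are two distinct rational
places at which `y` has the types `τ₁` and `τ₂`. -/
def SplitsWithTypes (F : Type*) {K L : Type*} [Field F] [Field K] [Field L] [Algebra F K]
    [Algebra F L] [Algebra K L] (A : ValuationSubring K) (y : L) (τ₁ τ₂ : PlaceType) : Prop :=
  ∃ B₁ B₂ : ValuationSubring L,
    B₁.comap (algebraMap K L) = A ∧ B₂.comap (algebraMap K L) = A ∧ B₁ ≠ B₂ ∧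
    HasPlaceType F B₁ y τ₁ ∧ HasPlaceType F B₂ y τ₂ ∧
    (∀ B : ValuationSubring L, B.comap (algebraMap K L) = A → B = B₁ ∨ B = B₂) ∧
    ∀ B : ValuationSubring L, B.comap (algebraMap K L) = A →
      IsRationalPlace F B ∧ ∀ s, A.IsUniformizer s → B.IsUniformizer (algebraMap K L s)

theorem add_inv_mem_of_notMem {x : K} (hx : x ∉ A) : x + 1 + 1 / x - x ∈ A := by
  have h1 := (A.valuation_le_one_iff _).1 (inv_mem_of_notMem hx).le
  have h2 := A.add_mem _ _ A.one_mem h1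
  convert h2 using 1
  ring

theorem PoleChain.hasPlaceType_ramified (hA : ∀ c : F, algebraMap F K c ∈ A) {x : K} {m : ℕ}
    (h : PoleChain F A m x) : HasPlaceType F A x (.ramified m) :=
  h.congr (add_inv_mem_of_notMem (h.notMem hA))

theorem valuation_lt_one_of_one_div_notMem {z : K} (hz : 1 / z ∉ A) : A.valuation z < 1 := by
  have := inv_mem_of_notMem hz
  simpa using this

theorem valuation_add_one_eq_one {z : K} (hz : A.valuation z < 1) : A.valuation (z + 1) = 1 := by
  rw [Valuation.map_add_eq_of_lt_right] <;> simp [hz]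

theorem IsRationalPlace.eq_zero_of_valuation_lt_one (hA : IsRationalPlace F A) {c : F}
    (hc : A.valuation (algebraMap F K c) < 1) : c = 0 := by
  by_contra h
  exact hc.ne (valuation_algebraMap_eq_one hA.algebraMap_mem h)

section Split

variable [IsAlgClosed F] {x : K} {y : L} (h : IsArtinSchreierGenerator (x + 1 + 1 / x) y) {t : K}
  (ht : A.IsUniformizer t) (hA : IsRationalPlace F A)

include h ht hA

/-- Here f ≡ x ≡ ℘(g) with g a pole chain of length m. On both places above, y differs from g by a
regular function, so y has a pole and y + 1 + 1/y inherits the chain. -/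
theorem splits_unramifiedPole {m : ℕ} (hx : HasPlaceType F A x (.unramifiedPole m)) :
    SplitsWithTypes F A y (.ramified m) (.ramified m) := by
  have hxA := DualPoleChain.notMem hA.algebraMap_mem hx
  obtain ⟨g, hg, hgx⟩ := DualPoleChain.exists_poleChain hA.algebraMap_mem hx
  obtain ⟨c, B₁, B₂, hB₁, hB₂, hne, hy₁, hy₂, hall, hu⟩ := h.exists_split_of_sub_mem ht hA g (by
    have := A.add_mem _ _ (add_inv_mem_of_notMem hxA) hgx
    rwa [sub_add_sub_cancel] at this)
  refine ⟨B₁, B₂, hB₁, hB₂, hne, ?_, ?_, hall, hu⟩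
  · obtain ⟨hr, hu⟩ := hu B₁ hB₁
    refine ((hg.map hB₁ hu).congr ?_).hasPlaceType_ramified hr.algebraMap_mem
    have := B₁.add_mem _ _ ((B₁.valuation_le_one_iff _).1 hy₁.le) (hr.algebraMap_mem c)
    rwa [sub_add_cancel] at this
  · obtain ⟨hr, hu⟩ := hu B₂ hB₂
    refine ((hg.map hB₂ hu).congr ?_).hasPlaceType_ramified hr.algebraMap_mem
    have := B₂.add_mem _ _ (B₂.add_mem _ _ ((B₂.valuation_le_one_iff _).1 hy₂.le) B₂.one_mem)
      (hr.algebraMap_mem c)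
    rwa [sub_add_cancel, sub_add_cancel] at this

/-- f + 1 = (x + 1)²/x vanishes, so y² + y + 1 does too and y tends to a cube root ω. The identity
1/(y+ω) + 1/(y+ω+1) = 1/(y²+y+1) = ℘(1/(x+1)), whose second term is regular, lengthens the chain by
one. -/
theorem splits_one {m : ℕ} (hx : HasPlaceType F A x (.one m)) :
    SplitsWithTypes F A y (.cubeRoot (m + 1)) (.cubeRoot (m + 1)) := by
  have h2 := h.two_eq_zero
  have h2' := h.two_eq_zero'
  have hr := PoleChain.notMem hA.algebraMap_mem hx
  have hx1 := valuation_lt_one_of_one_div_notMem hr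
  have hx1' : x + 1 ≠ 0 := by
    intro h0
    rw [h0, div_zero] at hr
    exact hr A.zero_mem
  have hxv : A.valuation x = 1 := by
    have := valuation_add_one_eq_one hx1
    rwa [show x + 1 + 1 = x by linear_combination h2] at this
  have hx0 : x ≠ 0 := by rintro rfl; simp at hxv
  have hxA := (A.valuation_le_one_iff x).1 hxv.le
  have hfm : A.valuation (x + 1 + 1 / x + 1) < 1 := by
    have h3 : x + 1 + 1 / x + 1 = (x + 1) ^ 2 / x := by grind
    rw [h3, map_div₀, hxv, div_one, map_pow]
    exact pow_lt_one₀ zero_le hx1 two_ne_zero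
  obtain ⟨c, B₁, B₂, hB₁, hB₂, hne, hy₁, hy₂, hall, hu⟩ :=
    h.exists_split_of_sub_mem ht hA 0 (by
      have := A.sub_mem ((A.valuation_le_one_iff _).1 hfm.le) A.one_mem
      simpa using this)
  rw [map_zero, sub_zero] at hy₁ hy₂
  have key : ∀ (B : ValuationSubring L) (ω : F), B.comap (algebraMap K L) = A →
      B.valuation (y - algebraMap F L ω) < 1 →
      HasPlaceType F B y (.cubeRoot (m + 1)) := by
    intro B ω hB hyω
    obtain ⟨hrB, huB⟩ := hu B hB
    have hf' : B.valuation (y ^ 2 + y + 1) < 1 := by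
      rw [h.equation, ← map_one (algebraMap K L), ← map_add, valuation_algebraMap_lt_one_iff hB]
      exact hfm
    have hωB := hrB.algebraMap_mem ω
    have hω : ω ^ 2 + ω + 1 = 0 := by
      apply hrB.eq_zero_of_valuation_lt_one
      simp only [map_add, map_pow, map_one]
      have hyB : y ∈ B := by
        have := B.add_mem _ _ ((B.valuation_le_one_iff _).1 hyω.le) hωB
        rwa [sub_add_cancel] at this
      have h3 : B.valuation ((y - algebraMap F L ω) * (y + algebraMap F L ω + 1)) < 1 := by
        rw [map_mul]
        refine mul_lt_one_of_lt_of_le hyω ?_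
        rw [B.valuation_le_one_iff]
        exact B.add_mem _ _ (B.add_mem _ _ hyB hωB) B.one_mem
      have h4 := Valuation.map_sub_lt _ hf' h3
      convert h4 using 2
      ring
    refine ⟨ω, hω, .step ω hω (PoleChain.map hB huB hx) ?_⟩
    have hω' := congrArg (algebraMap F L) hω
    simp only [map_add, map_pow, map_one, map_zero] at hω'
    have he := h.equation
    simp only [map_add, map_div₀, map_one] at he ⊢
    have hx1L : algebraMap K L x + 1 ≠ 0 := by
      rw [← map_one (algebraMap K L), ← map_add]; exact (map_ne_zero _).2 hx1'
    have hx0L : algebraMap K L x ≠ 0 := by simpa using hx0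
    have hu1 := valuation_add_one_eq_one hyω
    set w := algebraMap F L ω
    set X := algebraMap K L x
    have huB : 1 / (y - w + 1) ∈ B := by
      rw [← B.valuation_le_one_iff, map_div₀, hu1]; simp
    have hu0 : y - w + 1 ≠ 0 := by
      intro h0
      rw [h0] at hu1
      simp at hu1
    have hprod : (y + w) * (y - w + 1) * X = (X + 1) ^ 2 := by
      field_simp at he
      grind
    have hyw : y + w ≠ 0 := by
      intro h0
      rw [h0, zero_mul, zero_mul] at hprod
      exact pow_ne_zero 2 hx1L hprod.symm
    have h5 := B.mul_mem _ _ hωB huB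
    convert h5 using 1
    have h8 : 1 / (y + w) + 1 / (y - w + 1) = (1 / (X + 1)) ^ 2 + 1 / (X + 1) := by
      have : 1 / (y + w) + 1 / (y - w + 1) = X / (X + 1) ^ 2 := by
        rw [← hprod]
        field_simp
        grind
      rw [this]
      field_simp
      grind
    rw [← h8, div_eq_mul_one_div w (y + w)]
    linear_combination -(w * (1 / (y - w + 1))) * h2'
  -- The two places carry the two primitive cube roots c and c + 1 as residues of y.
  refine ⟨B₁, B₂, hB₁, hB₂, hne, key B₁ c hB₁ hy₁, key B₂ (c + 1) hB₂ ?_, hall, hu⟩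
  rwa [map_add, map_one, ← sub_sub]

omit [IsAlgClosed F] in
-- f = (x + ω)(x + ω + 1)/x vanishes, so y is 0 or 1. In 1/y + 1/(y+1) = 1/f = ω/(x+ω) + ω²/(x+ω+1)
-- the last term is regular, as is one of the first two, so the other carries the chain of x. At y =
-- 0 it makes y + 1 + 1/y a pole chain.
theorem splits_cubeRoot {m : ℕ} (hx : HasPlaceType F A x (.cubeRoot m)) :
    SplitsWithTypes F A y (.ramified m) (.one m) := by
  have h2 := h.two_eq_zero
  have h2' := h.two_eq_zero'
  obtain ⟨ω, hω, hx⟩ := hx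
  have hr := hx.notMem hA.algebraMap_mem
  have hω0 := ne_zero_of_cube_root hω
  have hωA := hA.algebraMap_mem ω
  have hωv := valuation_algebraMap_eq_one hA.algebraMap_mem hω0
  have hω' := congrArg (algebraMap F K) hω
  simp only [map_add, map_pow, map_one, map_zero] at hω'
  set w := algebraMap F K ω with hw
  have hw0 : w ≠ 0 := by simpa [hw] using hω0
  have hxw : A.valuation (x + w) < 1 := by
    have := inv_mem_of_notMem hr
    rwa [inv_div, map_div₀, hωv, div_one] at this
  have hxw0 : x + w ≠ 0 := by
    intro h0
    rw [h0, div_zero] at hr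
    exact hr A.zero_mem
  have hxv : A.valuation x = 1 := by
    have := Valuation.map_sub_eq_of_lt_right A.valuation (hωv ▸ hxw)
    rwa [add_sub_cancel_right, hωv] at this
  have hx0 : x ≠ 0 := by rintro rfl; simp at hxv
  have hxw1 := valuation_add_one_eq_one hxw
  have hxw10 : x + w + 1 ≠ 0 := by
    intro h0; rw [h0] at hxw1; simp at hxw1
  have hfe : x + 1 + 1 / x = (x + w) * (x + w + 1) / x := by
    field_simp
    grind
  have hfm : A.valuation (x + 1 + 1 / x) < 1 := by
    rw [hfe, map_div₀, hxv, div_one, map_mul, hxw1, mul_one]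
    exact hxw
  have hinv : 1 / (x + 1 + 1 / x) = w / (x + w) + w ^ 2 / (x + w + 1) := by
    rw [hfe]
    field_simp
    grind
  have hregA : w ^ 2 / (x + w + 1) ∈ A := by
    rw [← A.valuation_le_one_iff, map_div₀, hxw1, div_one, map_pow, hωv, one_pow]
  obtain ⟨B₁, B₂, hB₁, hB₂, hne, hy₁, hy₂, hall, hu⟩ := h.exists_split_unramified ht hA hfm
  have hy0 : y ≠ 0 := fun h0 => h.notMem 0 (by simpa using h0.symm)
  have hy10 : y + 1 ≠ 0 := fun h0 => h.notMem 1 (by simp; linear_combination h2' - h0)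
  have hyinv : 1 / y + 1 / (y + 1) =
      algebraMap K L (w / (x + w)) + algebraMap K L (w ^ 2 / (x + w + 1)) := by
    rw [← map_add, ← hinv, map_div₀, ← h.equation, map_one]
    field_simp
    grind
  refine ⟨B₁, B₂, hB₁, hB₂, hne, ?_, ?_, hall, hu⟩
  · obtain ⟨hrB, huB⟩ := hu B₁ hB₁
    refine (hx.map hB₁ huB).congr ?_
    have h3 : 1 / (y + 1) ∈ B₁ := by
      rw [← B₁.valuation_le_one_iff, map_div₀, valuation_add_one_eq_one hy₁]; simp
    have h4 := (algebraMap_mem_iff hB₁ _).2 hregA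
    have h5 := B₁.add_mem _ _ (B₁.sub_mem h4 h3)
      (B₁.add_mem _ _ ((B₁.valuation_le_one_iff _).1 hy₁.le) B₁.one_mem)
    convert h5 using 1
    linear_combination hyinv
  · obtain ⟨hrB, huB⟩ := hu B₂ hB₂
    refine (hx.map hB₂ huB).congr ?_
    have h3 : 1 / y ∈ B₂ := by
      have := valuation_add_one_eq_one hy₂
      rw [show y + 1 + 1 = y by linear_combination h2'] at this
      rw [← B₂.valuation_le_one_iff, map_div₀, this]; simp
    have h4 := (algebraMap_mem_iff hB₂ _).2 hregA
    rw [show 1 / (y + 1) - algebraMap K L (w / (x + w)) =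
      algebraMap K L (w ^ 2 / (x + w + 1)) - 1 / y by linear_combination hyinv]
    exact B₂.sub_mem h4 h3

/-- y(y + 1) = (x² + x + 1)/x and y² + y + 1 = (x + 1)²/x are units, so y again avoids 0, 1, the
cube roots and ∞. -/
theorem splits_generic (hx : HasPlaceType F A x .generic) :
    SplitsWithTypes F A y .generic .generic := by
  have h2 := h.two_eq_zero
  obtain ⟨hx0, hx1, hx2⟩ := hx
  have hx0' : x ≠ 0 := by rintro rfl; simp at hx0
  have hfv : A.valuation (x + 1 + 1 / x) = 1 := by
    rw [show x + 1 + 1 / x = (x ^ 2 + x + 1) / x by field_simp, map_div₀, hx0, hx2, div_one]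
  have hf1v : A.valuation (x + 1 + 1 / x + 1) = 1 := by
    rw [show x + 1 + 1 / x + 1 = (x + 1) ^ 2 / x by grind, map_div₀, map_pow, hx0,
      hx1, div_one, one_pow]
  obtain ⟨c, B₁, B₂, hB₁, hB₂, hne, hy₁, hy₂, hall, hu⟩ :=
    h.exists_split_of_sub_mem ht hA 0 (by
      have := (A.valuation_le_one_iff _).1 hfv.le
      simpa using this)
  have key : ∀ B : ValuationSubring L, B.comap (algebraMap K L) = A →
      HasPlaceType F B y .generic := by
    intro B hB
    have h3 : B.valuation (y ^ 2 + y) = 1 := by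
      rw [h.equation, ← map_one B.valuation, ← map_one (algebraMap K L),
        valuation_algebraMap_eq_iff hB, hfv, map_one]
    have h4 : B.valuation (y ^ 2 + y + 1) = 1 := by
      rw [h.equation, ← map_one B.valuation, ← map_one (algebraMap K L), ← map_add,
        valuation_algebraMap_eq_iff hB, hf1v, map_one]
    have hyB : y ∈ B := mem_of_sq_add_self_mem ((B.valuation_le_one_iff _).1 h3.le)
    have h5 := (B.valuation_le_one_iff _).2 hyB
    have h6 := (B.valuation_le_one_iff _).2 (B.add_mem _ _ hyB B.one_mem)
    rw [show y ^ 2 + y = y * (y + 1) by ring, map_mul] at h3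
    refine ⟨le_antisymm h5 ?_, le_antisymm h6 ?_, h4⟩
    · rw [← h3]; exact mul_le_of_le_one_right' h6
    · rw [← h3]; exact mul_le_of_le_one_left' h5
  exact ⟨B₁, B₂, hB₁, hB₂, hne, key B₁ hB₁, key B₂ hB₂, hall, hu⟩

end Split

/-- Over a place of ramified type there is exactly one place of `K(y)`, `y² + y = x + 1 + 1 / x`,
and its ramification index is two. -/
theorem exists_ramified {x : K} {y : L} (h : IsArtinSchreierGenerator (x + 1 + 1 / x) y)
    (hA : IsRationalPlace F A) {m : ℕ} (hx : HasPlaceType F A x (.ramified m)) :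
    ∃ B : ValuationSubring L, B.comap (algebraMap K L) = A ∧ IsRationalPlace F B ∧
      DualPoleChain F B m y ∧ (∀ B', B'.comap (algebraMap K L) = A → B' = B) ∧
      ∃ (t : K) (s : L), A.IsUniformizer t ∧ B.IsUniformizer s ∧
        B.valuation (algebraMap K L t) = B.valuation s ^ 2 := by
  -- The generator y + g has a simple pole on its right-hand side, so the ramified theory applies to
  -- it; the dual chain, by contrast, is read off y itself.
  obtain ⟨g, hg⟩ := PoleChain.exists_isUniformizer_inv h.two_eq_zero hx
  have h1 := h.add g
  obtain ⟨B, hB⟩ := exists_comap_eq L A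
  refine ⟨B, hB, h1.isRationalPlace_of_ramified hg hB hA, ?_, fun B' hB' =>
    h1.eq_of_ramified hg hB' hB, _, _, hg, h1.isUniformizer_inv hg hB, ?_⟩
  · refine PoleChain.dual_of_ramified h.two_eq_zero' hB hA.algebraMap_mem (fun _ _ hg' hz =>
      h1.isUniformizer_inv_of_sub_mem hg hB hg' hz) hx ?_
    rw [h.equation, sub_self]
    exact B.zero_mem
  · have := (IsArtinSchreierGenerator.valuation_sq_eq
      (IsArtinSchreierGenerator.notMem_of_isUniformizer_inv hg) hB
      (by rw [h1.equation, sub_self]; exact B.zero_mem)).1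
    rw [map_inv₀, map_inv₀, map_inv₀, ← this, inv_pow]

end

/-! ### Points of curves and total ramification in degree two -/

section

open ValuationSubring Polynomial

namespace CurvePoint

variable {k K L : Type*} [Field k] [Field K] [Field L] [Algebra k K] [Algebra k L] [Algebra K L]

@[ext]
theorem ext {P Q : CurvePoint k K} (h : P.localRing = Q.localRing) : P = Q := by
  cases P; cases Q; cases h; rfl

/-- The point given by a valuation ring with a uniformizer. -/
def ofUniformizer (A : ValuationSubring K) (hA : ∀ c : k, algebraMap k K c ∈ A)
    (h : ∃ t, A.IsUniformizer t) : CurvePoint k K where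
  localRing := A
  algebraMap_mem := hA
  isDVR := h.choose_spec.isDiscreteValuationRing

theorem exists_isUniformizer (P : CurvePoint k K) : ∃ t, P.localRing.IsUniformizer t := by
  have := P.isDVR
  exact P.localRing.exists_isUniformizer

theorem map_maximalIdeal {P : CurvePoint k K} {Q : CurvePoint k L} (h : Q.LiesOver P) {t : K}
    (ht : P.localRing.IsUniformizer t) :
    (IsLocalRing.maximalIdeal P.localRing).map (localHom h) =
      Ideal.span {localHom h ⟨t, ht.mem⟩} := by
  rw [ht.maximalIdeal_eq, Ideal.map_span, Set.image_singleton]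

theorem isTotallyRamified_of_valuation_eq {P : CurvePoint k K} {Q : CurvePoint k L}
    (h : Q.LiesOver P) {t : K} {s : L} (ht : P.localRing.IsUniformizer t)
    (hs : Q.localRing.IsUniformizer s) (hdeg : Module.finrank K L = 2)
    (hv : Q.localRing.valuation (algebraMap K L t) = Q.localRing.valuation s ^ 2) :
    P.IsTotallyRamified L := by
  refine ⟨Q, h, ?_⟩
  rw [map_maximalIdeal h ht, hs.maximalIdeal_eq, hdeg, Ideal.span_singleton_pow,
    Ideal.span_singleton_eq_span_singleton]
  rw [← map_pow] at hv
  obtain ⟨u, hu⟩ := (Q.localRing.valuation_eq_iff _ _).1 hv.symm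
  exact ⟨u, Subtype.ext ((mul_comm _ _).trans hu)⟩

theorem not_isTotallyRamified_of_unramified {P : CurvePoint k K} {t : K}
    (ht : P.localRing.IsUniformizer t) (hdeg : Module.finrank K L = 2)
    (hu : ∀ B : ValuationSubring L, B.comap (algebraMap K L) = P.localRing →
      B.IsUniformizer (algebraMap K L t)) : ¬ P.IsTotallyRamified L := by
  rintro ⟨Q, h, hQ⟩
  have hs := hu Q.localRing h
  rw [map_maximalIdeal h ht, hs.maximalIdeal_eq, hdeg, Ideal.span_singleton_pow,
    Ideal.span_singleton_eq_span_singleton] at hQ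
  obtain ⟨u, hu⟩ := hQ
  have h1 : algebraMap K L t * ((u : Q.localRing) : L) = algebraMap K L t ^ 2 :=
    congrArg Subtype.val hu
  have h2 := congrArg Q.localRing.valuation h1
  rw [map_mul, Q.localRing.valuation_unit, mul_one, map_pow] at h2
  have h3 := pow_lt_self_of_lt_one₀ hs.valuation_pos hs.2.1 one_lt_two
  exact h3.ne h2.symm

end CurvePoint

/-! ### Places of the rational function field -/

section Rational

variable {F K : Type*} [Field F] [Field K] [Algebra F K]

theorem valuation_aeval_sub_lt_one {A : ValuationSubring K}
    (hA : ∀ c : F, algebraMap F K c ∈ A) {t : K} (ht : A.valuation t < 1) (p : F[X]) :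
    A.valuation (aeval t p - algebraMap F K (p.coeff 0)) < 1 := by
  have htA := (A.valuation_le_one_iff t).1 ht.le
  have hmem : ∀ q : F[X], aeval t q ∈ A := by
    intro q
    rw [aeval_eq_sum_range]
    refine sum_mem fun i _ => ?_
    rw [Algebra.smul_def]
    exact A.mul_mem _ _ (hA _) (pow_mem htA i)
  have h1 : aeval t p - algebraMap F K (p.coeff 0) = t * aeval t p.divX := by
    have e := congrArg (aeval t) p.X_mul_divX_add
    simp only [map_add, map_mul, aeval_X, aeval_C] at e
    linear_combination -e
  rw [h1, map_mul]
  exact mul_lt_one_of_lt_of_le ht ((A.valuation_le_one_iff _).2 (hmem _))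

/-- `K = F(t)` is the field of rational functions in `t`. -/
def IsRationalGenerator (F : Type*) {K : Type*} [Field F] [Field K] [Algebra F K] (t : K) : Prop :=
  ∀ z : K, ∃ p q : F[X], z = aeval t p / aeval t q

theorem exists_eq_pow_mul (t : K) {p : F[X]} (hp : p ≠ 0) :
    ∃ (n : ℕ) (q : F[X]), q.coeff 0 ≠ 0 ∧ aeval t p = t ^ n * aeval t q := by
  obtain ⟨q, hq, hq'⟩ := exists_eq_pow_rootMultiplicity_mul_and_not_dvd p hp 0
  rw [map_zero, sub_zero] at hq hq'
  refine ⟨rootMultiplicity 0 p, q, fun h => hq' (X_dvd_iff.2 h), ?_⟩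
  have e := congrArg (aeval t) hq
  rwa [map_mul, map_pow, aeval_X] at e

/-- Factor t out of numerator and denominator; the remaining polynomials have nonzero constant
terms. The data n, u, c are chosen before the place `A`, so one factorization gives the uniformizer,
the residue field and the uniqueness of the place t = 0. -/
theorem IsRationalGenerator.exists_eq_zpow_mul {t : K} (ht : IsRationalGenerator F t) {z : K}
    (hz : z ≠ 0) : ∃ (n : ℤ) (u : K) (c : F), c ≠ 0 ∧ z = t ^ n * u ∧
      ∀ A : ValuationSubring K, (∀ c : F, algebraMap F K c ∈ A) → A.valuation t < 1 →
        A.valuation u = 1 ∧ A.valuation (u - algebraMap F K c) < 1 := by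
  obtain ⟨p, q, rfl⟩ := ht z
  obtain ⟨hp0, hq0⟩ := div_ne_zero_iff.1 hz
  obtain ⟨n, p', hp', hp⟩ := exists_eq_pow_mul t (p := p) (by rintro rfl; simp at hp0)
  obtain ⟨m, q', hq', hq⟩ := exists_eq_pow_mul t (p := q) (by rintro rfl; simp at hq0)
  rw [hp] at hp0
  rw [hq] at hq0
  have ht0 : m ≠ 0 ∨ n ≠ 0 → t ≠ 0 := by
    rintro h rfl
    rcases h with h | h
    · simp [h] at hq0
    · simp [h] at hp0
  refine ⟨n - m, aeval t p' / aeval t q', p'.coeff 0 / q'.coeff 0, div_ne_zero hp' hq', ?_, ?_⟩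
  · rw [hp, hq]
    by_cases h : m ≠ 0 ∨ n ≠ 0
    · rw [zpow_sub₀ (ht0 h), zpow_natCast, zpow_natCast]
      field_simp
    · push Not at h
      simp [h.1, h.2]
  · intro A hA htA
    have hv : ∀ c : F, c ≠ 0 → A.valuation (algebraMap F K c) = 1 := fun c hc =>
      valuation_algebraMap_eq_one hA hc
    have hunit : ∀ r : F[X], r.coeff 0 ≠ 0 → A.valuation (aeval t r) = 1 := by
      intro r hr
      have h1 := valuation_aeval_sub_lt_one hA htA r
      rw [← hv _ hr] at h1
      have := Valuation.map_add_eq_of_lt_right A.valuation h1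
      rwa [sub_add_cancel, hv _ hr] at this
    refine ⟨by rw [map_div₀, hunit p' hp', hunit q' hq', div_one], ?_⟩
    have hq0' : aeval t q' ≠ 0 := right_ne_zero_of_mul hq0
    have hc0' : algebraMap F K (q'.coeff 0) ≠ 0 := by simpa using hq'
    have h1 : aeval t p' / aeval t q' - algebraMap F K (p'.coeff 0 / q'.coeff 0) =
        ((aeval t p' - algebraMap F K (p'.coeff 0)) * algebraMap F K (q'.coeff 0) -
        (aeval t q' - algebraMap F K (q'.coeff 0)) * algebraMap F K (p'.coeff 0)) /
        (aeval t q' * algebraMap F K (q'.coeff 0)) := by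
      rw [map_div₀]
      field_simp
      ring
    rw [h1, map_div₀, map_mul A.valuation (aeval t q'), hunit q' hq', hv _ hq', mul_one, div_one]
    refine Valuation.map_sub_lt _ ?_ ?_
    · rw [map_mul, hv _ hq', mul_one]
      exact valuation_aeval_sub_lt_one hA htA p'
    · rw [map_mul, hv _ hp', mul_one]
      exact valuation_aeval_sub_lt_one hA htA q'

theorem IsRationalGenerator.isUniformizer {t : K} (ht : IsRationalGenerator F t) (ht0 : t ≠ 0)
    {A : ValuationSubring K} (hA : ∀ c : F, algebraMap F K c ∈ A) (htA : A.valuation t < 1) :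
    A.IsUniformizer t := by
  refine ⟨ht0, htA, fun z hz => ?_⟩
  obtain ⟨n, u, c, hc, rfl, h⟩ := ht.exists_eq_zpow_mul hz
  exact ⟨n, by rw [map_mul, (h A hA htA).1, mul_one, map_zpow₀]⟩

theorem IsRationalGenerator.isRationalPlace {t : K} (ht : IsRationalGenerator F t) (ht0 : t ≠ 0)
    {A : ValuationSubring K} (hA : ∀ c : F, algebraMap F K c ∈ A) (htA : A.valuation t < 1) :
    IsRationalPlace F A := by
  refine ⟨hA, fun z hz => ?_⟩
  by_cases hz0 : z = 0
  · exact ⟨0, by simp [hz0]⟩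
  obtain ⟨n, u, c, hc, rfl, h⟩ := ht.exists_eq_zpow_mul hz0
  obtain ⟨h1, h2⟩ := h A hA htA
  have hpos := A.valuation_pos ht0
  rcases lt_trichotomy n 0 with hn | rfl | hn
  · exfalso
    rw [← A.valuation_le_one_iff, map_mul, h1, mul_one, map_zpow₀] at hz
    exact absurd (one_lt_zpow_of_neg₀ hpos htA hn) (not_lt.2 hz)
  · exact ⟨c, by simpa using h2⟩
  · refine ⟨0, ?_⟩
    rw [map_zero, sub_zero, map_mul, h1, mul_one, map_zpow₀]
    exact zpow_lt_one₀ hpos htA hn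

theorem IsRationalGenerator.eq_of_valuation_lt_one {t : K} (ht : IsRationalGenerator F t)
    (ht0 : t ≠ 0) {A A' : ValuationSubring K} (hA : ∀ c : F, algebraMap F K c ∈ A)
    (hA' : ∀ c : F, algebraMap F K c ∈ A') (htA : A.valuation t < 1) (htA' : A'.valuation t < 1) :
    A = A' := by
  ext z
  by_cases hz0 : z = 0
  · simp [hz0, A.zero_mem, A'.zero_mem]
  obtain ⟨n, u, c, hc, rfl, h⟩ := ht.exists_eq_zpow_mul hz0
  have key : ∀ C : ValuationSubring K, (∀ c : F, algebraMap F K c ∈ C) → C.valuation t < 1 →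
      (t ^ n * u ∈ C ↔ 0 ≤ n) := by
    intro C hC htC
    rw [← C.valuation_le_one_iff, map_mul, (h C hC htC).1, mul_one, map_zpow₀,
      zpow_le_one_iff_right_of_lt_one₀ (C.valuation_pos ht0) htC]
  rw [key A hA htA, key A' hA' htA']

/-- By transcendence t is not a unit of F[t], so Chevalley's theorem gives a valuation ring over
F[t] in which t is a nonunit. -/
theorem exists_valuation_lt_one {t : K} (ht : Transcendental F t) :
    ∃ A : ValuationSubring K, (∀ c : F, algebraMap F K c ∈ A) ∧ A.valuation t < 1 := by
  have htm : t ∈ Algebra.adjoin F {t} := Algebra.subset_adjoin rfl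
  obtain ⟨A, h1, h2⟩ := Ideal.image_subset_nonunits_valuationSubring
    (A := (Algebra.adjoin F {t}).toSubring) (Ideal.span {⟨t, htm⟩}) (by
      rw [Ne, Ideal.span_singleton_eq_top]
      intro hu
      obtain ⟨s, hs⟩ := isUnit_iff_exists_inv.1 hu
      have hs1 : t * (s : K) = 1 := congrArg Subtype.val hs
      obtain ⟨p, hp⟩ := (Algebra.adjoin_singleton_eq_range_aeval F t).le s.2
      have h3 : aeval t (X * p - 1) = 0 := by
        simp only [map_sub, map_mul, aeval_X, map_one]
        rw [sub_eq_zero, ← hs1]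
        exact congrArg _ hp
      have h4 := (transcendental_iff.1 ht) _ h3
      have h5 := congrArg (fun q => coeff q 0) h4
      simp at h5)
  refine ⟨A, fun c => h1 ((Algebra.adjoin F {t}).algebraMap_mem c), ?_⟩
  rw [← ValuationSubring.mem_nonunits_iff]
  exact h2 ⟨⟨t, htm⟩, Ideal.subset_span rfl, rfl⟩

/-- If every x − a were a unit, then, polynomials over F being products of linear factors, every
nonzero polynomial in x would be a unit and the valuation trivial. -/
theorem exists_valuation_sub_lt_one [IsAlgClosed F] {x : K} (hx : IsRationalGenerator F x)
    {A : ValuationSubring K} (hA : ∀ c : F, algebraMap F K c ∈ A) (htop : A ≠ ⊤) (hxA : x ∈ A) :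
    ∃ a : F, A.valuation (x - algebraMap F K a) < 1 := by
  by_contra! h
  apply htop
  have hx1 : ∀ a : F, A.valuation (x - algebraMap F K a) = 1 := fun a =>
    le_antisymm ((A.valuation_le_one_iff _).2 (A.sub_mem hxA (hA a))) (h a)
  have hp : ∀ p : F[X], p ≠ 0 → (aeval x p)⁻¹ ∈ A ∧ aeval x p ∈ A := by
    intro p hp
    have h1 := (IsAlgClosed.splits p).eq_prod_roots
    have h2 : aeval x p = algebraMap F K p.leadingCoeff *
        (p.roots.map fun a => x - algebraMap F K a).prod := by
      conv_lhs => rw [h1]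
      simp [map_multiset_prod, Multiset.map_map]
    have h3 : A.valuation (p.roots.map fun a => x - algebraMap F K a).prod = 1 := by
      rw [map_multiset_prod, Multiset.map_map]
      apply Multiset.prod_eq_one
      intro v hv
      obtain ⟨a, -, rfl⟩ := Multiset.mem_map.1 hv
      exact hx1 a
    constructor
    · rw [h2, mul_inv]
      refine A.mul_mem _ _ (by rw [← map_inv₀]; exact hA _) ?_
      rw [← A.valuation_le_one_iff, map_inv₀, h3, inv_one]
    · rw [h2]
      exact A.mul_mem _ _ (hA _) ((A.valuation_le_one_iff _).1 h3.le)
  ext z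
  simp only [mem_top, iff_true]
  obtain ⟨p, q, rfl⟩ := hx z
  by_cases hp0 : p = 0
  · simp [hp0, A.zero_mem]
  by_cases hq0 : q = 0
  · simp [hq0, A.zero_mem]
  rw [div_eq_mul_inv]
  exact A.mul_mem _ _ (hp p hp0).2 (hp q hq0).1

end Rational

end

/-! ### The function fields of the tower -/

section

open ValuationSubring Polynomial IntermediateField

section Tower

variable (F : Type*) {Ω : Type*} [Field F] [Field Ω] [Algebra F Ω] (x : ℕ → Ω)

/-- The coordinate `x_i` as a function on the curve `C_i`. -/
def towerCoord (i : ℕ) : towerField F x i :=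
  ⟨x i, subset_adjoin F _ ⟨i, le_rfl, rfl⟩⟩

theorem towerField_mono {i n : ℕ} (h : i ≤ n) : towerField F x i ≤ towerField F x n :=
  IntermediateField.adjoin.mono F _ _ fun _ ⟨j, hj, hy⟩ => ⟨j, hj.trans h, hy⟩

/-- The inclusion of function fields given by the cover `C_n → C_i`. -/
noncomputable def towerInclusion {i n : ℕ} (h : i ≤ n) : towerField F x i →+* towerField F x n :=
  (IntermediateField.inclusion (towerField_mono F x h)).toRingHom

theorem coe_algebraMap_towerField (i : ℕ) (a : towerField F x i) :
    ((algebraMap (towerField F x i) (towerField F x (i + 1)) a : towerField F x (i + 1)) : Ω) =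
      a := by
  have h : algebraMap (towerField F x i) (towerField F x (i + 1)) =
    (IntermediateField.inclusion (towerField_le_succ F x i)).toRingHom :=
      RingHom.algebraMap_toAlgebra _
  rw [h]
  exact IntermediateField.coe_inclusion (towerField_le_succ F x i) a

theorem coe_towerInclusion {i n : ℕ} (h : i ≤ n) (a : towerField F x i) :
    (towerInclusion F x h a : Ω) = a :=
  IntermediateField.coe_inclusion (towerField_mono F x h) a

theorem coe_algebraMap_base (i : ℕ) (c : F) :
    (algebraMap F (towerField F x i) c : Ω) = algebraMap F Ω c :=
  (IsScalarTower.algebraMap_apply F (towerField F x i) Ω c).symm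

instance towerAlgebra_isScalarTower (i : ℕ) :
    IsScalarTower F (towerField F x i) (towerField F x (i + 1)) :=
  IsScalarTower.of_algebraMap_eq fun c => Subtype.ext <| by
    rw [coe_algebraMap_towerField, coe_algebraMap_base, coe_algebraMap_base]

theorem towerInclusion_comp {i n : ℕ} (h : i + 1 ≤ n) :
    (towerInclusion F x h).comp (algebraMap (towerField F x i) (towerField F x (i + 1))) =
      towerInclusion F x ((Nat.le_succ i).trans h) := by
  refine RingHom.ext fun a => Subtype.ext ?_
  rw [RingHom.comp_apply, coe_towerInclusion, coe_towerInclusion, coe_algebraMap_towerField]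

variable {F x}

theorem comap_towerInclusion_self {i : ℕ} (A : ValuationSubring (towerField F x i)) :
    A.comap (towerInclusion F x le_rfl) = A := by
  ext z
  rw [mem_comap, show towerInclusion F x le_rfl z = z from
    Subtype.ext (coe_towerInclusion F x le_rfl z)]

theorem coe_towerCoord_add (i : ℕ) :
    ((towerCoord F x i + 1 + 1 / towerCoord F x i : towerField F x i) : Ω) =
      x i + 1 + 1 / x i := by
  rw [IntermediateField.coe_add, IntermediateField.coe_add, IntermediateField.coe_div,
    IntermediateField.coe_one]
  rfl

theorem towerCoord_equation (hx : IsTowerSequence F x) (i : ℕ) :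
    towerCoord F x (i + 1) ^ 2 + towerCoord F x (i + 1) =
      algebraMap (towerField F x i) (towerField F x (i + 1))
        (towerCoord F x i + 1 + 1 / towerCoord F x i) := by
  apply Subtype.ext
  rw [IntermediateField.coe_add, IntermediateField.coe_pow, coe_algebraMap_towerField,
    coe_towerCoord_add]
  exact hx.equation i

/-- The set E + Ey is closed under inverses because a + by has the conjugate a + b + by and their
product, the norm, lies in E. -/
theorem exists_eq_add_mul_of_mem_adjoin (h2 : (2 : Ω) = 0) {E : IntermediateField F Ω} {f : E}
    {y : Ω} (heq : y ^ 2 + y = f) {T : Set Ω} (hT : ∀ w ∈ T, w ∈ E ∨ w = y) {w : Ω}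
    (hw : w ∈ adjoin F T) : ∃ a b : E, w = a + b * y := by
  induction hw using adjoin_induction with
  | mem w hw =>
    rcases hT w hw with h | rfl
    · exact ⟨⟨w, h⟩, 0, by simp⟩
    · exact ⟨0, 1, by simp⟩
  | algebraMap c => exact ⟨algebraMap F _ c, 0, by simp⟩
  | add w w' _ _ h h' =>
    obtain ⟨a, b, rfl⟩ := h
    obtain ⟨a', b', rfl⟩ := h'
    exact ⟨a + a', b + b', by push_cast; ring⟩
  | mul w w' _ _ h h' =>
    obtain ⟨a, b, rfl⟩ := h
    obtain ⟨a', b', rfl⟩ := h'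
    refine ⟨a * a' + b * b' * f, a * b' + a' * b - b * b', ?_⟩
    push_cast
    linear_combination (b * b' : Ω) * heq
  | inv w _ h =>
    obtain ⟨a, b, rfl⟩ := h
    -- It is not yet known that y lies outside E, so the conjugate may vanish; then the element is b
    -- itself.
    by_cases hN : ((a : Ω) + b * y) * (a + b + b * y) = 0
    · rcases mul_eq_zero.1 hN with h | h
      · exact ⟨0, 0, by simp [h]⟩
      · refine ⟨b⁻¹, 0, ?_⟩
        have : (a : Ω) + b * y = b := by linear_combination h - b * h2
        simp [this]
    · have hN' : ((a : Ω) + b * y) * (a + b + b * y) =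
          ((a ^ 2 + a * b + b ^ 2 * f : E) : Ω) := by
        push_cast
        linear_combination (b ^ 2 : Ω) * heq + (a * b * y : Ω) * h2
      refine ⟨(a + b) / (a ^ 2 + a * b + b ^ 2 * f), b / (a ^ 2 + a * b + b ^ 2 * f), ?_⟩
      rw [IntermediateField.coe_div, IntermediateField.coe_div, ← hN']
      obtain ⟨h3, h4⟩ := mul_ne_zero_iff.1 hN
      push_cast
      field_simp

theorem exists_repr_towerField (h2 : (2 : F) = 0) (hx : IsTowerSequence F x) (i : ℕ)
    (z : towerField F x (i + 1)) : ∃ a b : towerField F x i,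
      z = algebraMap (towerField F x i) (towerField F x (i + 1)) a +
        algebraMap (towerField F x i) (towerField F x (i + 1)) b * towerCoord F x (i + 1) := by
  have h2Ω : (2 : Ω) = 0 := by
    have := congrArg (algebraMap F Ω) h2
    rwa [map_ofNat, map_zero] at this
  have heq : x (i + 1) ^ 2 + x (i + 1) =
      ((towerCoord F x i + 1 + 1 / towerCoord F x i : towerField F x i) : Ω) := by
    rw [hx.equation i, coe_towerCoord_add]
  obtain ⟨a, b, hab⟩ := exists_eq_add_mul_of_mem_adjoin h2Ω heq (T := {y | ∃ j ≤ i + 1, y = x j}) (by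
      rintro _ ⟨j, hj, rfl⟩
      rcases Nat.lt_or_ge i j with h | h
      · obtain rfl : j = i + 1 := by omega
        exact Or.inr rfl
      · exact Or.inl (subset_adjoin F _ ⟨j, h, rfl⟩)) z.2
  refine ⟨a, b, Subtype.ext ?_⟩
  rw [hab, IntermediateField.coe_add, IntermediateField.coe_mul, coe_algebraMap_towerField,
    coe_algebraMap_towerField]
  rfl

/-- A pole of a² + a has even order. This shows that every step of the tower really has degree two.
-/
theorem ValuationSubring.IsUniformizer.sq_add_self_ne {K : Type*} [Field K]
    {A : ValuationSubring K} {f : K} (hf : A.IsUniformizer f⁻¹) (a : K) : a ^ 2 + a ≠ f := by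
  intro h
  have hfA := IsArtinSchreierGenerator.notMem_of_isUniformizer_inv hf
  obtain ⟨h1, h3⟩ := IsArtinSchreierGenerator.valuation_sq_eq (B := A) (z := a) hfA
    (show A.comap (algebraMap K K) = A from rfl) (by simp [h, A.zero_mem])
  obtain ⟨n, hn⟩ := hf.2.2 a (by rintro rfl; simp at h3)
  have h4 : A.valuation f = A.valuation f⁻¹ ^ (-1 : ℤ) := by simp
  rw [hn, Algebra.algebraMap_self, RingHom.id_apply, h4, ← zpow_natCast, ← zpow_mul] at h1
  have h5 := zpow_right_injective₀ hf.valuation_pos hf.2.1.ne h1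
  simp only [Nat.cast_ofNat] at h5
  omega

theorem two_eq_zero_towerField (h2 : (2 : F) = 0) (i : ℕ) : (2 : towerField F x i) = 0 := by
  have := congrArg (algebraMap F (towerField F x i)) h2
  rwa [map_ofNat, map_zero] at this

theorem isRationalGenerator_of_mem {t : towerField F x 0} (ht : x 0 ∈ F⟮(t : Ω)⟯) :
    IsRationalGenerator F t := by
  intro z
  have h1 : towerField F x 0 ≤ F⟮(t : Ω)⟯ := by
    refine adjoin_le_iff.2 ?_
    rintro _ ⟨j, hj, rfl⟩
    obtain rfl : j = 0 := by omega
    exact ht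
  obtain ⟨p, q, hpq⟩ := (mem_adjoin_simple_iff F _).1 (h1 z.2)
  refine ⟨p, q, Subtype.ext ?_⟩
  rw [hpq, IntermediateField.coe_div]
  congr 1 <;> exact aeval_algebraMap_apply Ω t _

theorem transcendental_towerCoord (hx : IsTowerSequence F x) :
    Transcendental F (towerCoord F x 0) :=
  (transcendental_algebraMap_iff (algebraMap (towerField F x 0) Ω).injective).1
    hx.transcendental_zero

theorem towerCoord_zero_ne (hx : IsTowerSequence F x) (a : F) :
    towerCoord F x 0 ≠ algebraMap F _ a := fun h =>
  transcendental_towerCoord hx (h ▸ isAlgebraic_algebraMap a)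

theorem isRationalGenerator_inv : IsRationalGenerator F (towerCoord F x 0)⁻¹ :=
  isRationalGenerator_of_mem (by
    have := inv_mem (mem_adjoin_simple_self F (((towerCoord F x 0)⁻¹ : towerField F x 0) : Ω))
    rw [← IntermediateField.coe_inv, inv_inv] at this
    exact this)

theorem isRationalGenerator_sub (a : F) :
    IsRationalGenerator F (towerCoord F x 0 - algebraMap F _ a) :=
  isRationalGenerator_of_mem (by
    have := AddMemClass.add_mem (mem_adjoin_simple_self F
      ((towerCoord F x 0 - algebraMap F _ a : towerField F x 0) : Ω)) (IntermediateField.algebraMap_mem _ a)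
    convert this using 1
    rw [AddSubgroupClass.coe_sub]
    exact (sub_add_cancel _ _).symm)

theorem exists_place_infinity (hx : IsTowerSequence F x) :
    ∃ A : ValuationSubring (towerField F x 0), IsRationalPlace F A ∧
      A.IsUniformizer (towerCoord F x 0)⁻¹ := by
  have h0 : (towerCoord F x 0)⁻¹ ≠ 0 :=
    inv_ne_zero (by simpa using towerCoord_zero_ne hx 0)
  obtain ⟨A, hA, hv⟩ := exists_valuation_lt_one (F := F) (t := (towerCoord F x 0)⁻¹)
    fun h => transcendental_towerCoord hx (by simpa using h.inv)
  exact ⟨A, isRationalGenerator_inv.isRationalPlace h0 hA hv,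
    isRationalGenerator_inv.isUniformizer h0 hA hv⟩

theorem exists_place_finite (hx : IsTowerSequence F x) (a : F) :
    ∃ A : ValuationSubring (towerField F x 0), IsRationalPlace F A ∧
      A.IsUniformizer (towerCoord F x 0 - algebraMap F _ a) := by
  have h0 : towerCoord F x 0 - algebraMap F _ a ≠ 0 := sub_ne_zero.2 (towerCoord_zero_ne hx a)
  obtain ⟨A, hA, hv⟩ := exists_valuation_lt_one (F := F) (t := towerCoord F x 0 - algebraMap F _ a)
    fun h => transcendental_towerCoord hx
      (by simpa using h.add (isAlgebraic_algebraMap (R := F) (A := towerField F x 0) a))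
  exact ⟨A, (isRationalGenerator_sub a).isRationalPlace h0 hA hv,
    (isRationalGenerator_sub a).isUniformizer h0 hA hv⟩

theorem isArtinSchreierGenerator_of_place (h2 : (2 : F) = 0) (hx : IsTowerSequence F x) (i : ℕ)
    {A : ValuationSubring (towerField F x i)} (hA : A.IsUniformizer (towerCoord F x i)⁻¹) :
    IsArtinSchreierGenerator (towerCoord F x i + 1 + 1 / towerCoord F x i)
      (towerCoord F x (i + 1)) where
  two_eq_zero := two_eq_zero_towerField h2 i
  equation := towerCoord_equation hx i
  exists_repr := exists_repr_towerField h2 hx i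
  notMem a ha := by
    have h1 := hA.inv_congr (add_inv_mem_of_notMem
      (IsArtinSchreierGenerator.notMem_of_isUniformizer_inv hA))
    apply h1.sq_add_self_ne a
    apply (algebraMap (towerField F x i) (towerField F x (i + 1))).injective
    rw [← towerCoord_equation hx i, map_add, map_pow, ha]

/-- At the point of `C_i` at infinity, `x_i` has a simple pole. -/
theorem exists_isUniformizer_inv_towerCoord (h2 : (2 : F) = 0) (hx : IsTowerSequence F x) (i : ℕ) :
    ∃ A : ValuationSubring (towerField F x i), A.IsUniformizer (towerCoord F x i)⁻¹ := by
  induction i with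
  | zero =>
    obtain ⟨A, -, hA⟩ := exists_place_infinity hx
    exact ⟨A, hA⟩
  | succ i ih =>
    obtain ⟨A, hA⟩ := ih
    obtain ⟨B, hB⟩ := exists_comap_eq (towerField F x (i + 1)) A
    exact ⟨B, (isArtinSchreierGenerator_of_place h2 hx i hA).isUniformizer_inv
      (hA.inv_congr (add_inv_mem_of_notMem
        (IsArtinSchreierGenerator.notMem_of_isUniformizer_inv hA))) hB⟩

theorem isArtinSchreierGenerator_towerCoord (h2 : (2 : F) = 0) (hx : IsTowerSequence F x)
    (i : ℕ) : IsArtinSchreierGenerator (towerCoord F x i + 1 + 1 / towerCoord F x i)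
      (towerCoord F x (i + 1)) := by
  obtain ⟨A, hA⟩ := exists_isUniformizer_inv_towerCoord h2 hx i
  exact isArtinSchreierGenerator_of_place h2 hx i hA

/-- y is integral over K and valuation rings are integrally closed, so a place trivial on K is
trivial on L. -/
theorem IsArtinSchreierGenerator.eq_top_of_comap_eq_top {K L : Type*} [Field K] [Field L]
    [Algebra K L] {f : K} {y : L} (h : IsArtinSchreierGenerator f y) {B : ValuationSubring L}
    (hB : B.comap (algebraMap K L) = ⊤) : B = ⊤ := by
  have h1 : ∀ a, algebraMap K L a ∈ B := fun a => by
    rw [← mem_comap, hB]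
    exact ValuationSubring.mem_top a
  ext z
  simp only [ValuationSubring.mem_top, iff_true]
  obtain ⟨a, b, rfl⟩ := h.exists_repr z
  refine B.add_mem _ _ (h1 a) (B.mul_mem _ _ (h1 b) (mem_of_sq_add_self_mem ?_))
  rw [h.equation]
  exact h1 f

theorem comap_towerInclusion_ne_top (h2 : (2 : F) = 0) (hx : IsTowerSequence F x) {n : ℕ}
    (Q : CurvePoint F (towerField F x n)) :
    Q.localRing.comap (towerInclusion F x (Nat.zero_le n)) ≠ ⊤ := by
  intro htop
  have key : ∀ (j : ℕ) (hj : j ≤ n), Q.localRing.comap (towerInclusion F x hj) = ⊤ := by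
    intro j
    induction j with
    | zero => exact fun _ => htop
    | succ j ih =>
      intro hj
      have h1 := ih ((Nat.le_succ j).trans hj)
      rw [← towerInclusion_comp F x hj, ← comap_comap] at h1
      exact (isArtinSchreierGenerator_towerCoord h2 hx j).eq_top_of_comap_eq_top h1
  obtain ⟨t, ht⟩ := Q.exists_isUniformizer
  have h1 : t⁻¹ ∈ Q.localRing := by
    rw [← comap_towerInclusion_self Q.localRing, key n le_rfl]
    exact ValuationSubring.mem_top _
  rw [← inv_inv t] at ht
  exact IsArtinSchreierGenerator.notMem_of_isUniformizer_inv ht h1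

end Tower

end

/-! ### Counting ramified points over a place of given type -/

section

open ValuationSubring Polynomial IntermediateField

/-- The number of ramified points of `C_{i+k}` over a point of `C_i` of the given type. -/
def PlaceType.count : PlaceType → ℕ → ℕ
  | .ramified _, 0 => 1
  | .unramifiedPole _, 0 => 0
  | .one _, 0 => 0
  | .cubeRoot _, 0 => 0
  | .generic, _ => 0
  | .ramified 0, k + 1 => PlaceType.count (.ramified 0) k
  | .ramified (m + 1), k + 1 => PlaceType.count (.unramifiedPole m) k
  | .unramifiedPole m, k + 1 => PlaceType.count (.ramified m) k + PlaceType.count (.ramified m) k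
  | .one m, k + 1 =>
      PlaceType.count (.cubeRoot (m + 1)) k + PlaceType.count (.cubeRoot (m + 1)) k
  | .cubeRoot m, k + 1 => PlaceType.count (.ramified m) k + PlaceType.count (.one m) k

section Count

variable {F Ω : Type*} [Field F] [Field Ω] [Algebra F Ω] {x : ℕ → Ω}

/-- The points of `C_n` that are totally ramified in `C_{n+1}` and lie over the place `A` of
`C_i`. -/
def ramifiedPointsOver {i n : ℕ} (h : i ≤ n) (A : ValuationSubring (towerField F x i)) :
    Set (CurvePoint F (towerField F x n)) :=
  {Q | Q ∈ totallyRamifiedPoints F x n ∧ Q.localRing.comap (towerInclusion F x h) = A}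

theorem disjoint_ramifiedPointsOver {i n : ℕ} (h : i ≤ n)
    {A A' : ValuationSubring (towerField F x i)} (hne : A ≠ A') :
    Disjoint (ramifiedPointsOver h A) (ramifiedPointsOver h A') :=
  Set.disjoint_left.2 fun _ hQ hQ' => hne (hQ.2.symm.trans hQ'.2)

theorem ramifiedPointsOver_of_unique {i n : ℕ} (h : i + 1 ≤ n)
    {A : ValuationSubring (towerField F x i)} {B : ValuationSubring (towerField F x (i + 1))}
    (hB : B.comap (algebraMap (towerField F x i) (towerField F x (i + 1))) = A)
    (hall : ∀ B' : ValuationSubring (towerField F x (i + 1)),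
      B'.comap (algebraMap (towerField F x i) (towerField F x (i + 1))) = A → B' = B) :
    ramifiedPointsOver ((Nat.le_succ i).trans h) A = ramifiedPointsOver h B := by
  ext Q
  refine and_congr_right fun _ => ?_
  rw [← towerInclusion_comp F x h, ← comap_comap]
  exact ⟨fun hQ => hall _ hQ, fun hQ => hQ ▸ hB⟩

theorem ramifiedPointsOver_of_pair {i n : ℕ} (h : i + 1 ≤ n)
    {A : ValuationSubring (towerField F x i)} {B₁ B₂ : ValuationSubring (towerField F x (i + 1))}
    (hB₁ : B₁.comap (algebraMap (towerField F x i) (towerField F x (i + 1))) = A)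
    (hB₂ : B₂.comap (algebraMap (towerField F x i) (towerField F x (i + 1))) = A)
    (hall : ∀ B' : ValuationSubring (towerField F x (i + 1)),
      B'.comap (algebraMap (towerField F x i) (towerField F x (i + 1))) = A →
        B' = B₁ ∨ B' = B₂) :
    ramifiedPointsOver ((Nat.le_succ i).trans h) A =
      ramifiedPointsOver h B₁ ∪ ramifiedPointsOver h B₂ := by
  ext Q
  rw [Set.mem_union]
  unfold ramifiedPointsOver
  simp only [Set.mem_ofPred_eq]
  rw [← and_or_left]
  refine and_congr_right fun _ => ?_
  rw [← towerInclusion_comp F x h, ← comap_comap]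
  refine ⟨fun hQ => hall _ hQ, ?_⟩
  rintro (hQ | hQ)
  · exact hQ ▸ hB₁
  · exact hQ ▸ hB₂

/-- Every place of ramified type gives a totally ramified point. -/
theorem isTotallyRamified_of_ramified (h2 : (2 : F) = 0) (hx : IsTowerSequence F x) {i m : ℕ}
    {P : CurvePoint F (towerField F x i)} (hP : IsRationalPlace F P.localRing)
    (hτ : HasPlaceType F P.localRing (towerCoord F x i) (.ramified m)) :
    P ∈ totallyRamifiedPoints F x i := by
  have h := isArtinSchreierGenerator_towerCoord h2 hx i
  obtain ⟨B, hB, hr, -, -, t, s, ht, hs, hv⟩ := exists_ramified h hP hτ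
  exact CurvePoint.isTotallyRamified_of_valuation_eq
    (Q := CurvePoint.ofUniformizer B hr.algebraMap_mem ⟨s, hs⟩) hB ht hs h.finrank_eq hv

theorem notMem_totallyRamifiedPoints_of_splits (h2 : (2 : F) = 0) (hx : IsTowerSequence F x)
    {i : ℕ} {P : CurvePoint F (towerField F x i)} {τ₁ τ₂ : PlaceType}
    (hτ : SplitsWithTypes F P.localRing (towerCoord F x (i + 1)) τ₁ τ₂) :
    P ∉ totallyRamifiedPoints F x i := by
  have h := isArtinSchreierGenerator_towerCoord h2 hx i
  obtain ⟨-, -, -, -, -, -, -, -, hu⟩ := hτ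
  obtain ⟨t, ht⟩ := P.exists_isUniformizer
  exact CurvePoint.not_isTotallyRamified_of_unramified ht h.finrank_eq
    fun B hB => (hu B hB).2 t ht

theorem ramifiedPointsOver_self {i : ℕ} {A : ValuationSubring (towerField F x i)}
    (hA : IsRationalPlace F A) (hu : ∃ t, A.IsUniformizer t) :
    ramifiedPointsOver le_rfl A = {Q | Q ∈ totallyRamifiedPoints F x i ∧
      Q = CurvePoint.ofUniformizer A hA.algebraMap_mem hu} := by
  ext Q
  refine and_congr_right fun _ => ?_
  rw [CurvePoint.ext_iff, comap_towerInclusion_self]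
  rfl

/-- A split place is not itself totally ramified, so it contributes nothing at its own level; higher
up, its points are shared between its two disjoint fibres. The hypothesis `ih` is asked for only
when levels remain, so that the lemma serves both cases of the induction on k. -/
theorem ncard_ramifiedPointsOver_of_splits (h2 : (2 : F) = 0) (hx : IsTowerSequence F x)
    {i k : ℕ} {A : ValuationSubring (towerField F x i)} (hA : IsRationalPlace F A)
    (hu : ∃ t, A.IsUniformizer t) {τ₁ τ₂ : PlaceType}
    (hτ : SplitsWithTypes F A (towerCoord F x (i + 1)) τ₁ τ₂) {n : ℕ} (hn : i + k = n)
    (ih : ∀ {k'}, k = k' + 1 → ∀ (τ : PlaceType)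
      (B : ValuationSubring (towerField F x (i + 1))), IsRationalPlace F B →
      (∃ t, B.IsUniformizer t) → HasPlaceType F B (towerCoord F x (i + 1)) τ →
      ∀ h : i + 1 ≤ n, (ramifiedPointsOver h B).Finite ∧
        (ramifiedPointsOver h B).ncard = τ.count k') :
    (ramifiedPointsOver (hn ▸ Nat.le_add_right i k) A).Finite ∧
      (ramifiedPointsOver (hn ▸ Nat.le_add_right i k) A).ncard =
        k.casesOn 0 fun k' => τ₁.count k' + τ₂.count k' := by
  cases k with
  | zero =>
    obtain rfl : i = n := hn
    have h3 : ramifiedPointsOver le_rfl A = ∅ := by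
      rw [ramifiedPointsOver_self hA hu]
      ext Q
      simp only [Set.mem_ofPred_eq, Set.mem_empty_iff_false, iff_false, not_and]
      rintro hQ rfl
      exact notMem_totallyRamifiedPoints_of_splits h2 hx
        (P := CurvePoint.ofUniformizer A hA.algebraMap_mem hu) hτ hQ
    rw [h3]
    simp
  | succ k =>
    have h : i + 1 ≤ n := by omega
    obtain ⟨B₁, B₂, hB₁, hB₂, hne, hτ₁, hτ₂, hall, hun⟩ := hτ
    obtain ⟨t, ht⟩ := hu
    obtain ⟨hf₁, hc₁⟩ := ih rfl τ₁ B₁ (hun B₁ hB₁).1 ⟨_, (hun B₁ hB₁).2 t ht⟩ hτ₁ h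
    obtain ⟨hf₂, hc₂⟩ := ih rfl τ₂ B₂ (hun B₂ hB₂).1 ⟨_, (hun B₂ hB₂).2 t ht⟩ hτ₂ h
    rw [ramifiedPointsOver_of_pair h hB₁ hB₂ hall]
    refine ⟨hf₁.union hf₂, ?_⟩
    rw [Set.ncard_union_eq (disjoint_ramifiedPointsOver h hne) hf₁ hf₂, hc₁, hc₂]

/-- Induction on the number k of levels still to climb, for all types and starting levels at once,
since the type changes at every step. -/
theorem ncard_ramifiedPointsOver [IsAlgClosed F] (h2 : (2 : F) = 0) (hx : IsTowerSequence F x)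
    (k : ℕ) : ∀ (τ : PlaceType) (i : ℕ) (A : ValuationSubring (towerField F x i)),
      IsRationalPlace F A → (∃ t, A.IsUniformizer t) → HasPlaceType F A (towerCoord F x i) τ →
      ∀ (n : ℕ) (_ : i + k = n) (h : i ≤ n),
        (ramifiedPointsOver h A).Finite ∧ (ramifiedPointsOver h A).ncard = τ.count k := by
  induction k with
  | zero =>
    intro τ i A hA hu hτ n hn h
    have has := isArtinSchreierGenerator_towerCoord h2 hx i
    obtain ⟨t, ht⟩ := id hu
    have hsplit : ∀ {τ₁ τ₂}, SplitsWithTypes F A (towerCoord F x (i + 1)) τ₁ τ₂ →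
        (ramifiedPointsOver h A).Finite ∧ (ramifiedPointsOver h A).ncard = 0 := fun hs =>
      ncard_ramifiedPointsOver_of_splits h2 hx hA hu hs hn (by intro k' hk; omega)
    cases τ with
    | ramified m =>
      obtain rfl : i = n := hn
      have h3 : ramifiedPointsOver le_rfl A =
          {CurvePoint.ofUniformizer A hA.algebraMap_mem hu} := by
        rw [ramifiedPointsOver_self hA hu]
        ext Q
        simp only [Set.mem_ofPred_eq, Set.mem_singleton_iff, and_iff_right_iff_imp]
        rintro rfl
        exact isTotallyRamified_of_ramified h2 hx
          (P := CurvePoint.ofUniformizer A hA.algebraMap_mem hu) hA hτ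
      rw [h3]
      exact ⟨Set.finite_singleton _, Set.ncard_singleton _⟩
    | unramifiedPole m => exact hsplit (splits_unramifiedPole has ht hA hτ)
    | one m => exact hsplit (splits_one has ht hA hτ)
    | cubeRoot m => exact hsplit (splits_cubeRoot has ht hA hτ)
    | generic => exact hsplit (splits_generic has ht hA hτ)
  | succ k ih =>
    intro τ i A hA hu hτ n hn h
    have has := isArtinSchreierGenerator_towerCoord h2 hx i
    obtain ⟨t, ht⟩ := id hu
    have hn' : i + 1 + k = n := by omega
    have h' : i + 1 ≤ n := by omega
    have hsplit : ∀ {τ₁ τ₂}, SplitsWithTypes F A (towerCoord F x (i + 1)) τ₁ τ₂ →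
        (ramifiedPointsOver h A).Finite ∧
          (ramifiedPointsOver h A).ncard = τ₁.count k + τ₂.count k := fun hs =>
      ncard_ramifiedPointsOver_of_splits h2 hx hA hu hs hn (by
        intro k' hk τ B hB huB hτB h
        obtain rfl : k = k' := by omega
        exact ih τ (i + 1) B hB huB hτB n hn' h)
    cases τ with
    | ramified m =>
      obtain ⟨B, hB, hr, hd, hall, -, s, -, hs, -⟩ := exists_ramified has hA hτ
      rw [ramifiedPointsOver_of_unique h' hB hall]
      cases m with
      | zero =>
        refine ih (.ramified 0) (i + 1) B hr ⟨s, hs⟩ ?_ n hn' h'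
        -- A dual chain of length 0 is just a simple pole, so the place above is again of type
        -- ramified 0 and ramification continues forever.
        cases hd with
        | simple h3 => exact (PoleChain.simple h3).hasPlaceType_ramified hr.algebraMap_mem
      | succ m => exact ih (.unramifiedPole m) (i + 1) B hr ⟨s, hs⟩ hd n hn' h'
    | unramifiedPole m => exact hsplit (splits_unramifiedPole has ht hA hτ)
    | one m => exact hsplit (splits_one has ht hA hτ)
    | cubeRoot m => exact hsplit (splits_cubeRoot has ht hA hτ)
    | generic =>
      have h3 := hsplit (splits_generic has ht hA hτ)
      cases k <;> exact h3

end Count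

end

/-! ### The contributing points of the projective line -/

section

open ValuationSubring Polynomial IntermediateField

section BasePoints

variable {F Ω : Type*} [Field F] [Field Ω] [Algebra F Ω] {x : ℕ → Ω}

theorem ncard_ramified_comap_mem {n : ℕ} (S : Finset (ValuationSubring (towerField F x 0)))
    (c : ValuationSubring (towerField F x 0) → ℕ)
    (hS : ∀ A ∈ S, (ramifiedPointsOver (Nat.zero_le n) A).Finite ∧
      (ramifiedPointsOver (Nat.zero_le n) A).ncard = c A) :
    {Q | Q ∈ totallyRamifiedPoints F x n ∧
      Q.localRing.comap (towerInclusion F x (Nat.zero_le n)) ∈ S}.Finite ∧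
    {Q | Q ∈ totallyRamifiedPoints F x n ∧
      Q.localRing.comap (towerInclusion F x (Nat.zero_le n)) ∈ S}.ncard = ∑ A ∈ S, c A := by
  classical
  induction S using Finset.induction_on with
  | empty => simp
  | insert A S hA ih =>
    obtain ⟨h1, h2⟩ := ih fun B hB => hS B (Finset.mem_insert_of_mem hB)
    obtain ⟨h3, h4⟩ := hS A (Finset.mem_insert_self A S)
    have h5 : {Q | Q ∈ totallyRamifiedPoints F x n ∧
        Q.localRing.comap (towerInclusion F x (Nat.zero_le n)) ∈ insert A S} =
        ramifiedPointsOver (Nat.zero_le n) A ∪ {Q | Q ∈ totallyRamifiedPoints F x n ∧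
          Q.localRing.comap (towerInclusion F x (Nat.zero_le n)) ∈ S} := by
      ext Q
      simp only [ramifiedPointsOver, Finset.mem_insert, Set.mem_union, Set.mem_ofPred_eq]
      tauto
    rw [h5, Finset.sum_insert hA, ← h2, ← h4]
    refine ⟨h3.union h1, Set.ncard_union_eq (Set.disjoint_left.2 ?_) h3 h1⟩
    rintro Q hQ hQ'
    exact hA (hQ.2 ▸ hQ'.2)

theorem hasPlaceType_infinity {A : ValuationSubring (towerField F x 0)}
    (hA : IsRationalPlace F A) (hu : A.IsUniformizer (towerCoord F x 0)⁻¹) :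
    HasPlaceType F A (towerCoord F x 0) (.ramified 0) :=
  (PoleChain.simple hu).hasPlaceType_ramified hA.algebraMap_mem

theorem hasPlaceType_zero {A : ValuationSubring (towerField F x 0)}
    (hu : A.IsUniformizer (towerCoord F x 0)) :
    HasPlaceType F A (towerCoord F x 0) (.ramified 0) := by
  have h1 : PoleChain F A 0 (1 / towerCoord F x 0) := .simple (by simpa using hu)
  refine h1.congr ?_
  rw [add_sub_cancel_right]
  exact A.add_mem _ _ hu.mem A.one_mem

theorem hasPlaceType_one {A : ValuationSubring (towerField F x 0)}
    (hu : A.IsUniformizer (towerCoord F x 0 + 1)) :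
    HasPlaceType F A (towerCoord F x 0) (.one 0) :=
  .simple (by simpa using hu)

theorem hasPlaceType_cubeRoot {A : ValuationSubring (towerField F x 0)}
    (hA : IsRationalPlace F A) {ω : F} (hω : ω ^ 2 + ω + 1 = 0)
    (hu : A.IsUniformizer (towerCoord F x 0 + algebraMap F _ ω)) :
    HasPlaceType F A (towerCoord F x 0) (.cubeRoot 0) := by
  refine ⟨ω, hω, .simple (hu.congr ?_)⟩
  rw [inv_div, map_div₀, valuation_algebraMap_eq_one hA.algebraMap_mem (ne_zero_of_cube_root hω),
    div_one]

theorem hasPlaceType_generic (h2 : (2 : F) = 0) {A : ValuationSubring (towerField F x 0)}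
    (hA : IsRationalPlace F A) {a : F} (h0 : a ≠ 0) (h1 : a ≠ 1) (hω : a ^ 2 + a + 1 ≠ 0)
    (hu : A.valuation (towerCoord F x 0 - algebraMap F _ a) < 1) :
    HasPlaceType F A (towerCoord F x 0) .generic := by
  have key : ∀ (z : towerField F x 0) (c : F), c ≠ 0 →
      A.valuation (z - algebraMap F _ c) < 1 → A.valuation z = 1 := by
    intro z c hc hz
    have hv := valuation_algebraMap_eq_one hA.algebraMap_mem hc
    rw [← hv] at hz
    have := Valuation.map_add_eq_of_lt_right A.valuation hz
    rwa [sub_add_cancel, hv] at this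
  have h1' : a + 1 ≠ 0 := fun h => h1 (by linear_combination h - h2)
  refine ⟨key _ a h0 hu, key _ (a + 1) h1' ?_, key _ (a ^ 2 + a + 1) hω ?_⟩
  · rwa [map_add, map_one, add_sub_add_right_eq_sub]
  · have h3 : towerCoord F x 0 ^ 2 + towerCoord F x 0 + 1 - algebraMap F _ (a ^ 2 + a + 1) =
        (towerCoord F x 0 - algebraMap F _ a) * (towerCoord F x 0 + algebraMap F _ a + 1) := by
      simp only [map_add, map_pow, map_one]
      ring
    rw [h3, map_mul]
    refine mul_lt_one_of_lt_of_le hu ((A.valuation_le_one_iff _).2 ?_)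
    have hxA := A.add_mem _ _ ((A.valuation_le_one_iff _).1 hu.le) (hA.algebraMap_mem a)
    rw [sub_add_cancel] at hxA
    exact A.add_mem _ _ (A.add_mem _ _ hxA (hA.algebraMap_mem a)) A.one_mem

/-- The number of ramified points is the sum of the contributions of the points of the projective
line with `x₀ = ∞, 0, 1` and the two primitive cube roots of unity. -/
theorem ncard_totallyRamifiedPoints_eq_count [IsAlgClosed F] (h2 : (2 : F) = 0)
    (hx : IsTowerSequence F x) (n : ℕ) :
    (totallyRamifiedPoints F x n).Finite ∧ (totallyRamifiedPoints F x n).ncard =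
      2 * PlaceType.count (.ramified 0) n + PlaceType.count (.one 0) n +
        2 * PlaceType.count (.cubeRoot 0) n := by
  classical
  obtain ⟨ω, hω⟩ : ∃ ω : F, ω ^ 2 + ω + 1 = 0 := by
    have hd : (X ^ 2 + X + 1 : F[X]).degree ≠ 0 := by
      have : (X ^ 2 + X + 1 : F[X]).degree = 2 := by compute_degree!
      rw [this]
      decide
    obtain ⟨c, hc⟩ := IsAlgClosed.exists_root _ hd
    exact ⟨c, by simpa [Polynomial.IsRoot] using hc⟩
  have hω' : (ω + 1) ^ 2 + (ω + 1) + 1 = 0 := by linear_combination hω + (ω + 1) * h2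
  have hω0 := ne_zero_of_cube_root hω
  have hω1 : ω ≠ 1 := by
    rintro rfl
    exact one_ne_zero (α := F) (by linear_combination hω - h2)
  obtain ⟨A', hA', hu'⟩ := exists_place_infinity hx
  choose A hA hu using exists_place_finite hx
  have hneg : ∀ a : F, towerCoord F x 0 - algebraMap F (towerField F x 0) a =
      towerCoord F x 0 + algebraMap F _ a := fun a => by
    linear_combination -algebraMap F _ a * two_eq_zero_towerField (x := x) h2 0
  have hinj : Function.Injective A := by
    intro a b hab
    have h3 := (hu a).2.1
    have h4 := (hu b).2.1
    rw [← hab] at h4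
    have h5 := Valuation.map_sub_lt _ h4 h3
    rw [sub_sub_sub_cancel_left, ← map_sub] at h5
    exact sub_eq_zero.1 ((hA a).eq_zero_of_valuation_lt_one h5)
  have hne : ∀ a, A' ≠ A a := by
    intro a h
    apply IsArtinSchreierGenerator.notMem_of_isUniformizer_inv hu'
    rw [h]
    have := (A a).add_mem _ _ (hu a).mem ((hA a).algebraMap_mem a)
    rwa [sub_add_cancel] at this
  let S : Finset (ValuationSubring (towerField F x 0)) :=
    insert A' (insert (A 0) (insert (A 1) (insert (A ω) {A (ω + 1)})))
  have hcount : ∀ (B : ValuationSubring (towerField F x 0)) (τ : PlaceType),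
      IsRationalPlace F B → (∃ t, B.IsUniformizer t) →
      HasPlaceType F B (towerCoord F x 0) τ →
      (ramifiedPointsOver (Nat.zero_le n) B).Finite ∧
        (ramifiedPointsOver (Nat.zero_le n) B).ncard = τ.count n := fun B τ hB huB hτ =>
    ncard_ramifiedPointsOver h2 hx n τ 0 B hB huB hτ n (Nat.zero_add n) _
  have h_inf := hcount A' _ hA' ⟨_, hu'⟩ (hasPlaceType_infinity hA' hu')
  have h_zero := hcount (A 0) _ (hA 0) ⟨_, hu 0⟩ (hasPlaceType_zero (by simpa using hu 0))
  have h_one := hcount (A 1) _ (hA 1) ⟨_, hu 1⟩ (hasPlaceType_one (by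
    have := hu 1
    rwa [hneg, map_one] at this))
  have h_root : ∀ a : F, a ^ 2 + a + 1 = 0 → _ := fun a ha =>
    hcount (A a) _ (hA a) ⟨_, hu a⟩ (hasPlaceType_cubeRoot (hA a) ha (by
      have := hu a
      rwa [hneg] at this))
  -- Every ramified point lies over one of the five special places: the other places x₀ = a are
  -- generic and have no ramified point above them.
  have htotal : totallyRamifiedPoints F x n = {Q | Q ∈ totallyRamifiedPoints F x n ∧
      Q.localRing.comap (towerInclusion F x (Nat.zero_le n)) ∈ S} := by
    ext Q
    refine ⟨fun hQ => ⟨hQ, ?_⟩, fun hQ => hQ.1⟩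
    set B := Q.localRing.comap (towerInclusion F x (Nat.zero_le n)) with hB
    have htop : B ≠ ⊤ := comap_towerInclusion_ne_top h2 hx Q
    have hBF : ∀ c : F, algebraMap F _ c ∈ B := by
      intro c
      rw [hB, mem_comap]
      have h3 : towerInclusion F x (Nat.zero_le n) (algebraMap F _ c) = algebraMap F _ c :=
        Subtype.ext (by rw [coe_towerInclusion, coe_algebraMap_base, coe_algebraMap_base])
      rw [h3]
      exact Q.algebraMap_mem c
    by_cases hxB : towerCoord F x 0 ∈ B
    · obtain ⟨a, ha⟩ := exists_valuation_sub_lt_one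
        (isRationalGenerator_of_mem (mem_adjoin_simple_self F _)) hBF htop hxB
      have hBA : B = A a := (isRationalGenerator_sub a).eq_of_valuation_lt_one (hu a).1 hBF
        (hA a).algebraMap_mem ha (hu a).2.1
      have hcases : a = 0 ∨ a = 1 ∨ a = ω ∨ a = ω + 1 := by
        by_contra! hcon
        obtain ⟨h3, h4, h5, h6⟩ := hcon
        have h7 : a ^ 2 + a + 1 ≠ 0 := by
          intro h7
          have h8 : (a - ω) * (a - (ω + 1)) = 0 := by
            linear_combination h7 + hω + (-a * ω - a - 1) * h2
          rcases mul_eq_zero.1 h8 with h9 | h9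
          · exact h5 (sub_eq_zero.1 h9)
          · exact h6 (sub_eq_zero.1 h9)
        obtain ⟨h8, h9⟩ := hcount (A a) _ (hA a) ⟨_, hu a⟩
          (hasPlaceType_generic h2 (hA a) h3 h4 h7 (hu a).2.1)
        rw [show PlaceType.count .generic n = 0 by cases n <;> rfl, Set.ncard_eq_zero h8] at h9
        have h10 : Q ∈ ramifiedPointsOver (Nat.zero_le n) (A a) := ⟨hQ, hBA⟩
        rw [h9] at h10
        exact h10
      rw [hBA]
      rcases hcases with rfl | rfl | rfl | rfl <;> simp [S]
    · have hBA : B = A' := isRationalGenerator_inv.eq_of_valuation_lt_one hu'.1 hBF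
        hA'.algebraMap_mem (inv_mem_of_notMem hxB) hu'.2.1
      rw [hBA]
      simp [S]
  rw [htotal]
  obtain ⟨h3, h4⟩ := ncard_ramified_comap_mem S
    (fun B => (ramifiedPointsOver (n := n) (Nat.zero_le n) B).ncard) (by
      intro B hB
      refine ⟨?_, rfl⟩
      simp only [S, Finset.mem_insert, Finset.mem_singleton] at hB
      rcases hB with rfl | rfl | rfl | rfl | rfl
      exacts [h_inf.1, h_zero.1, h_one.1, (h_root ω hω).1, (h_root (ω + 1) hω').1])
  refine ⟨h3, h4.trans ?_⟩
  have e1 : (0 : F) ≠ ω + 1 := fun h => hω1 (by linear_combination -h - h2)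
  have e2 : (1 : F) ≠ ω + 1 := fun h => hω0 (by linear_combination -h)
  have e3 : ω ≠ ω + 1 := fun h => one_ne_zero (α := F) (by linear_combination -h)
  rw [Finset.sum_insert (by simp [hne]), Finset.sum_insert (by simp [hinj.eq_iff, hω0.symm, e1]),
    Finset.sum_insert (by simp [hinj.eq_iff, hω1.symm, hω0]),
    Finset.sum_insert (by simp [hinj.eq_iff]), Finset.sum_singleton, h_inf.2, h_zero.2, h_one.2,
    (h_root ω hω).2, (h_root (ω + 1) hω').2]
  ring

end BasePoints

end

/-! ### Solving the recursion for the counts -/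

namespace PlaceType

theorem count_ramified_zero (k : ℕ) : count (.ramified 0) k = 1 := by
  induction k with
  | zero => rfl
  | succ k ih => exact ih

/-- Two levels, one ramified and one split, lower m by one and double the places. -/
theorem count_ramified_succ_add_two (m k : ℕ) :
    count (.ramified (m + 1)) (k + 2) = 2 * count (.ramified m) k := by
  rw [two_mul]; rfl

/-- Doubling occurs every second level until m is used up; from then on all 2^m places ramify at
every level. -/
theorem count_ramified_even (h : ℕ) : ∀ m, count (.ramified m) (2 * h) = 2 ^ min m h := by
  induction h with
  | zero =>
    intro m
    simp [count]
  | succ h ih =>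
    intro m
    cases m with
    | zero => simp [count_ramified_zero]
    | succ m =>
      rw [mul_add_one, count_ramified_succ_add_two, ih, Nat.succ_min_succ, pow_succ]
      ring

/-- At odd distance the places are unramified poles as long as m is not used up, so nothing ramifies
before that. -/
theorem count_ramified_odd (h : ℕ) :
    ∀ m, count (.ramified m) (2 * h + 1) = if m ≤ h then 2 ^ m else 0 := by
  induction h with
  | zero =>
    intro m
    cases m with
    | zero => simp [count_ramified_zero]
    | succ m => simp [count]
  | succ h ih =>
    intro m
    cases m with
    | zero => simp [count_ramified_zero]
    | succ m =>
      rw [show 2 * (h + 1) + 1 = 2 * h + 1 + 2 by ring, count_ramified_succ_add_two, ih]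
      simp only [Nat.add_le_add_iff_right, pow_succ]
      split_ifs <;> ring

theorem count_cubeRoot_add_two (m k : ℕ) : count (.cubeRoot m) (k + 2) =
    count (.ramified m) (k + 1) + 2 * count (.cubeRoot (m + 1)) k := by
  rw [two_mul]
  rfl

/-- Since a place of type one 0 splits into two of type cubeRoot 1, exactly this sum of counts at
adjacent levels enters the total, and for m = 0 the added 2^m = 1 is the contribution of ramified 0.
Raising h by one doubles the sum for m + 1 and adds two ramified counts, so m must be free in the
induction; the two regimes reflect the minimum in `count_ramified_even`. -/
theorem count_cubeRoot_odd (h : ℕ) : ∀ m,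
    (m ≤ h → count (.cubeRoot m) (2 * h + 1) + count (.cubeRoot (m + 1)) (2 * h) + 2 ^ m =
      2 ^ h * (2 + (h + m) / 2)) ∧
    (h < m → count (.cubeRoot m) (2 * h + 1) + count (.cubeRoot (m + 1)) (2 * h) =
      2 ^ h * (h + 1)) := by
  induction h with
  | zero =>
    intro m
    refine ⟨fun hm => ?_, fun hm => ?_⟩
    · obtain rfl : m = 0 := by omega
      simp [count]
    · simp [count]
  | succ h ih =>
    intro m
    have h1 := count_cubeRoot_add_two m (2 * h + 1)
    have h2 := count_cubeRoot_add_two (m + 1) (2 * h)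
    have h3 := count_ramified_even (h + 1) m
    have h4 := count_ramified_odd h (m + 1)
    rw [show 2 * (h + 1) + 1 = 2 * h + 1 + 2 by ring, show 2 * (h + 1) = 2 * h + 2 by ring, h1, h2]
    rw [show 2 * (h + 1) = 2 * h + 1 + 1 by ring] at h3
    rw [h3, h4]
    obtain ⟨ih1, ih2⟩ := ih (m + 1)
    constructor
    · intro hm
      rw [min_eq_left hm]
      rcases Nat.lt_or_ge m h with hlt | hge
      · have := ih1 hlt
        rw [if_pos (by omega), show h + 1 + m = h + (m + 1) by ring]
        rw [pow_succ] at this ⊢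
        rw [pow_succ 2 h]
        linarith
      -- At the boundary m = h or m = h + 1 the raised index m + 1 exceeds h, so the induction
      -- hypothesis comes from the other regime.
      · have := ih2 (by omega)
        rw [if_neg (by omega)]
        rcases Nat.lt_or_ge h m with hlt | hge'
        · obtain rfl : m = h + 1 := by omega
          rw [show (h + 1 + (h + 1)) / 2 = h + 1 by omega]
          rw [pow_succ] at *
          linarith
        · obtain rfl : m = h := by omega
          rw [show (m + 1 + m) / 2 = m by omega, pow_succ]
          linarith
    · intro hm
      have := ih2 (by omega)
      rw [if_neg (by omega), min_eq_right (by omega), pow_succ]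
      linarith

/-- The same argument as for `count_cubeRoot_odd`, one level higher: the parities of the two
ramified counts are exchanged. -/
theorem count_cubeRoot_even (h : ℕ) : ∀ m,
    (m ≤ h → count (.cubeRoot m) (2 * h + 2) + count (.cubeRoot (m + 1)) (2 * h + 1) + 2 ^ m =
      2 ^ h * (3 + (h + m) / 2)) ∧
    (h < m → count (.cubeRoot m) (2 * h + 2) + count (.cubeRoot (m + 1)) (2 * h + 1) =
      2 ^ h * (h + 1)) := by
  induction h with
  | zero =>
    intro m
    refine ⟨fun hm => ?_, fun hm => ?_⟩
    · obtain rfl : m = 0 := by omega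
      simp [count]
    · obtain ⟨m, rfl⟩ : ∃ k, m = k + 1 := ⟨m - 1, by omega⟩
      simp [count]
  | succ h ih =>
    intro m
    have h1 := count_cubeRoot_add_two m (2 * h + 2)
    have h2 := count_cubeRoot_add_two (m + 1) (2 * h + 1)
    have h3 := count_ramified_odd (h + 1) m
    have h4 := count_ramified_even (h + 1) (m + 1)
    rw [show 2 * (h + 1) + 2 = 2 * h + 2 + 2 by ring,
      show 2 * (h + 1) + 1 = 2 * h + 1 + 2 by ring, h1, h2]
    rw [show 2 * (h + 1) + 1 = 2 * h + 2 + 1 by ring] at h3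
    rw [show 2 * (h + 1) = 2 * h + 1 + 1 by ring] at h4
    rw [h3, h4]
    obtain ⟨ih1, ih2⟩ := ih (m + 1)
    constructor
    · intro hm
      rw [if_pos hm]
      rcases Nat.lt_or_ge m h with hlt | hge
      · have := ih1 hlt
        rw [min_eq_left (by omega), show h + 1 + m = h + (m + 1) by ring]
        rw [pow_succ] at this ⊢
        rw [pow_succ 2 h]
        linarith
      · have := ih2 (by omega)
        rw [min_eq_right (by omega)]
        rcases Nat.lt_or_ge h m with hlt | hge'
        · obtain rfl : m = h + 1 := by omega
          rw [show (h + 1 + (h + 1)) / 2 = h + 1 by omega]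
          rw [pow_succ] at *
          linarith
        · obtain rfl : m = h := by omega
          rw [show (m + 1 + m) / 2 = m by omega, pow_succ]
          linarith
    · intro hm
      have := ih2 (by omega)
      rw [if_neg (by omega), min_eq_right (by omega), pow_succ]
      linarith

/-- The total number of ramified points in terms of the level. -/
theorem count_total_odd (h : ℕ) :
    2 * count (.ramified 0) (2 * h + 1) + count (.one 0) (2 * h + 1) +
      2 * count (.cubeRoot 0) (2 * h + 1) = ((2 * h + 1) / 4 + 2) * 2 ^ (h + 1) := by
  have h1 := (count_cubeRoot_odd h 0).1 (Nat.zero_le h)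
  have h2 : count (.one 0) (2 * h + 1) = 2 * count (.cubeRoot 1) (2 * h) := by
    rw [two_mul (count _ _)]; rfl
  rw [count_ramified_zero, h2, show (2 * h + 1) / 4 = h / 2 by omega, pow_succ]
  simp only [zero_add, pow_zero, add_zero] at h1
  linarith

theorem count_total_even (h : ℕ) :
    2 * count (.ramified 0) (2 * h) + count (.one 0) (2 * h) +
      2 * count (.cubeRoot 0) (2 * h) = ((2 * h + 2) / 4 + 2) * 2 ^ h := by
  cases h with
  | zero => simp [count]
  | succ h =>
    have h1 := (count_cubeRoot_even h 0).1 (Nat.zero_le h)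
    have h2 : count (.one 0) (2 * h + 2) = 2 * count (.cubeRoot 1) (2 * h + 1) := by
      rw [two_mul (count _ _)]; rfl
    rw [count_ramified_zero, show 2 * (h + 1) = 2 * h + 2 by ring, h2,
      show (2 * h + 2 + 2) / 4 = h / 2 + 1 by omega, pow_succ]
    simp only [zero_add, pow_zero, add_zero] at h1
    linarith

end PlaceType

theorem mainTheorem4 (F : Type*) [Field F] [Algebra (ZMod 2) F] [IsAlgClosure (ZMod 2) F]
    (Ω : Type*) [Field Ω] [Algebra F Ω] (x : ℕ → Ω) (hx : IsTowerSequence F x) (i : ℕ) :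
    (totallyRamifiedPoints F x i).Finite ∧
    (Even i → (totallyRamifiedPoints F x i).ncard = ((i + 2) / 4 + 2) * 2 ^ (i / 2)) ∧
    (Odd i → (totallyRamifiedPoints F x i).ncard = (i / 4 + 2) * 2 ^ ((i + 1) / 2)) := by
  have : IsAlgClosed F := IsAlgClosure.isAlgClosed (ZMod 2)
  have h2 : (2 : F) = 0 := by
    have := congrArg (algebraMap (ZMod 2) F) (show (2 : ZMod 2) = 0 from rfl)
    rwa [map_ofNat, map_zero] at this
  obtain ⟨hfin, hcard⟩ := ncard_totallyRamifiedPoints_eq_count h2 hx i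
  refine ⟨hfin, fun hi => ?_, fun hi => ?_⟩
  · obtain ⟨h, rfl⟩ := hi.exists_two_nsmul
    rw [smul_eq_mul] at hcard ⊢
    rw [hcard, PlaceType.count_total_even, Nat.mul_div_cancel_left h two_pos]
  · obtain ⟨h, rfl⟩ := hi
    rw [hcard, PlaceType.count_total_odd, show (2 * h + 1 + 1) / 2 = h + 1 by omega]
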